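/- **Theorem 5.6.** A classical scalar weight is one of the following, with its second-order operator $\delta$ acting on the right ($p\cdot\sum_j\partial^jF_j=\sum_j p^{(j)}F_j$): shifted Hermite, $e^{-x^2+2bx}$ on $\mathbb R$ with $b\in\mathbb R$ and $\delta=\partial^2-2\partial(x-b)$; Laguerre, $e^{-x}x^{\alpha}$ on $(0,\infty)$ with $\alpha>-1$ and $\delta=\partial^2x+\partial(\alpha+1-x)$; Jacobi, $(1-x)^\alpha(1+x)^\beta$ on $(-1,1)$ with $\alpha,\beta>-1$ and $\delta=\partial^2(1-x^2)+\partial(\beta-\alpha-x(\alpha+\beta+2))$. For an $N\times N$ matrix weight $W$ on an interval, let $\langle P,Q\rangle_W=\int P(x)W(x)Q(x)^*\,dx$ for $P,Q\in \mathrm{Mat}_N(\mathbb C[x])$. A sequence of orthogonal polynomials for $W$ is a sequence $(Q_n)_{n\ge0}$ in $\mathrm{Mat}_N(\mathbb C[x])$ in which $Q_n$ has degree $n$ and nonsingular leading coefficient and $\langle Q_n,Q_m\rangle_W=0$ for $n\ne m$. Let $\mathrm{Mat}_N(\Omega[x])$ be the algebra of operators $D=\sum_j\partial^jF_j(x)$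 (finite sums, $F_j\in \mathrm{Mat}_N(\mathbb C[x])$), acting on the right by $P\cdot D=\sum_jP^{(j)}F_j$. Let $\mathcal D(W)$ be the algebra of those $D$ for which $Q_n\cdot D=\Lambda_n(D)Q_n$ with some $\Lambda_n(D)\in \mathrm{Mat}_N(\mathbb C)$ for all $n\ge0$, where $(Q_n)$ is any sequence of orthogonal polynomials for $W$, and let $\mathcal Z(W)$ be the center of $\mathcal D(W)$. For weights $W,\widetilde W$ of the same size on the same interval, with monic orthogonal polynomials $P_n,\widetilde P_n$, say that $\widetilde W$ is a Darboux transformation of $W$ if there is $D\in\mathcal D(W)$ with $D=\mathcal V\mathcal N$, where $\mathcal V,\mathcal N\in \mathrm{Mat}_N(\Omega[x])$ preserve the degree of every matrix polynomial and $P_n\cdot\mathcal V=A_n\widetilde P_n$ for some $A_n\in \mathrm{Mat}_N(\mathbb C)$, for all $n\ge 0$. Write $w\sim\widetilde w$ for scalar weights if $\widetilde w$ is a Darboux transformation of $w$. Let $W=W_1\oplus\cdots\oplus W_m$ with $W_i=w_{i,1}\oplus\cdots\oplus w_{i,k_i}$ and $k_i\ge1$, where all $w_{i,j}$ are classical scalar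 weights of the same type (all shifted Hermite, all Laguerre, or all Jacobi), $w_{i,j}\sim w_{i,\ell}$ for all $i,j,\ell$, and $w_{i,\ell}\not\sim w_{r,j}$ for all $\ell,j$ whenever $i\ne r$. Let $\delta_{i,j}$ be the second-order operator of $w_{i,j}$ and let $\Delta_i=\operatorname{diag}(\delta_{i,1},\dots,\delta_{i,k_i})$. Then $$\mathcal Z(W)=\bigoplus_{i=1}^m\mathcal Z(W_i)=\mathbb C[\Delta_1]\oplus\cdots\oplus\mathbb C[\Delta_m],$$ where $\mathbb C[\Delta_i]=\{p(\Delta_i):p\in\mathbb C[t]\}$ and the direct sums are embedded in $\mathrm{Mat}_{k_1+\cdots+k_m}(\Omega[x])$ as block diagonal operators. -/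

import Mathlib

open scoped Polynomial Matrix

noncomputable section

namespace MVOP

/-! ### Differential operators with polynomial coefficients, acting on the right -/

/-- Linear endomorphisms of `ℂ[x]`, multiplied in the order in which they act from the right:
`p · (A * B) = (p · A) · B`. -/
abbrev RightEnd : Type := (Module.End ℂ ℂ[X])ᵐᵒᵖ

/-- The operator `∂ = d/dx`. -/
def ddx : RightEnd := MulOpposite.op Polynomial.derivative

/-- The operator of order zero `p ↦ p f`. -/
def mulBy (f : ℂ[X]) : RightEnd := MulOpposite.op (LinearMap.mulRight ℂ f)

@[simp] theorem ddx_apply (p : ℂ[X]) : ddx.unop p = Polynomial.derivative p := rfl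

@[simp] theorem mulBy_apply (f p : ℂ[X]) : (mulBy f).unop p = p * f := rfl

theorem mulBy_mul (f g : ℂ[X]) : mulBy f * mulBy g = mulBy (f * g) := by
  refine MulOpposite.unop_injective (LinearMap.ext fun p => ?_)
  simp [mul_assoc]

theorem mulBy_add (f g : ℂ[X]) : mulBy (f + g) = mulBy f + mulBy g := by
  refine MulOpposite.unop_injective (LinearMap.ext fun p => ?_)
  simp [mul_add]

theorem mulBy_smul (c : ℂ) (f : ℂ[X]) : mulBy (c • f) = c • mulBy f := by
  refine MulOpposite.unop_injective (LinearMap.ext fun p => ?_)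
  simp

theorem mulBy_one : mulBy 1 = 1 := by
  refine MulOpposite.unop_injective (LinearMap.ext fun p => ?_)
  simp

theorem mulBy_zero : mulBy 0 = 0 := by
  refine MulOpposite.unop_injective (LinearMap.ext fun p => ?_)
  simp

/-- The Leibniz rule, written for operators acting on the right. -/
theorem mulBy_mul_ddx (f : ℂ[X]) :
    mulBy f * ddx = ddx * mulBy f + mulBy (Polynomial.derivative f) := by
  refine MulOpposite.unop_injective (LinearMap.ext fun p => ?_)
  simp

/-- `IsDiffOp D` says that `D = ∑ j, ∂ ^ j * F j` for finitely many polynomials `F j`. -/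
def IsDiffOp (D : RightEnd) : Prop :=
  ∃ F : ℕ →₀ ℂ[X], D = F.sum fun j f => ddx ^ j * mulBy f

theorem IsDiffOp.add {D E : RightEnd} (hD : IsDiffOp D) (hE : IsDiffOp E) :
    IsDiffOp (D + E) := by
  obtain ⟨F, rfl⟩ := hD
  obtain ⟨G, rfl⟩ := hE
  refine ⟨F + G, (Finsupp.sum_add_index' ?_ ?_).symm⟩
  · intro j
    simp [mulBy_zero]
  · intro j f g
    rw [mulBy_add, mul_add]

theorem isDiffOp_monomial (j : ℕ) (f : ℂ[X]) : IsDiffOp (ddx ^ j * mulBy f) :=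
  ⟨Finsupp.single j f, by rw [Finsupp.sum_single_index]; simp [mulBy_zero]⟩

theorem isDiffOp_zero : IsDiffOp 0 := ⟨0, by simp⟩

theorem isDiffOp_sum (F : ℕ →₀ ℂ[X]) (g : ℕ → ℂ[X] → RightEnd) (h : ∀ j f, IsDiffOp (g j f)) :
    IsDiffOp (F.sum g) :=
  Finset.sum_induction _ IsDiffOp (fun _ _ => IsDiffOp.add) isDiffOp_zero fun _ _ => h _ _

theorem IsDiffOp.mul_ddx {D : RightEnd} (hD : IsDiffOp D) : IsDiffOp (D * ddx) := by
  obtain ⟨F, rfl⟩ := hD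
  rw [Finsupp.sum_mul]
  refine isDiffOp_sum F _ fun j f => ?_
  rw [mul_assoc, mulBy_mul_ddx, mul_add, ← mul_assoc, ← pow_succ]
  exact (isDiffOp_monomial _ _).add (isDiffOp_monomial _ _)

theorem IsDiffOp.mul_mulBy {D : RightEnd} (hD : IsDiffOp D) (g : ℂ[X]) :
    IsDiffOp (D * mulBy g) := by
  obtain ⟨F, rfl⟩ := hD
  rw [Finsupp.sum_mul]
  refine isDiffOp_sum F _ fun j f => ?_
  rw [mul_assoc, mulBy_mul]
  exact isDiffOp_monomial _ _

theorem IsDiffOp.mul {D E : RightEnd} (hD : IsDiffOp D) (hE : IsDiffOp E) :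
    IsDiffOp (D * E) := by
  obtain ⟨G, rfl⟩ := hE
  rw [Finsupp.mul_sum]
  refine isDiffOp_sum G _ fun j g => ?_
  rw [← mul_assoc]
  refine IsDiffOp.mul_mulBy ?_ g
  induction j with
  | zero => simpa using hD
  | succ j ih => rw [pow_succ, ← mul_assoc]; exact ih.mul_ddx

theorem isDiffOp_ddx : IsDiffOp ddx := by
  simpa [mulBy_one] using isDiffOp_monomial 1 1

theorem isDiffOp_mulBy (f : ℂ[X]) : IsDiffOp (mulBy f) := by
  simpa using isDiffOp_monomial 0 f

theorem isDiffOp_algebraMap (c : ℂ) : IsDiffOp (algebraMap ℂ RightEnd c) := by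
  rw [Algebra.algebraMap_eq_smul_one, ← mulBy_one, ← mulBy_smul]
  exact isDiffOp_mulBy _

/-- The coefficients `F j` of an operator `∑ j, ∂ ^ j F j` are determined by its action. -/
theorem coeff_eq_zero (F : ℕ →₀ ℂ[X]) (h : (F.sum fun j f => ddx ^ j * mulBy f) = 0) : F = 0 := by
  have hpow : ∀ (j : ℕ) (p : ℂ[X]), (ddx ^ j).unop p = Polynomial.derivative^[j] p := by
    intro j
    induction j with
    | zero => intro p; simp
    | succ j ih => intro p; rw [pow_succ, Function.iterate_succ_apply', ← ih p]; rfl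
  have hp : ∀ p : ℂ[X], ∑ j ∈ F.support, Polynomial.derivative^[j] p * F j = 0 := by
    intro p
    have h1 := congrArg (fun D : RightEnd => D.unop p) h
    simpa [Finsupp.sum, LinearMap.sum_apply, hpow, -MulOpposite.unop_pow] using h1
  ext1 j
  induction j using Nat.strong_induction_on with
  | _ j ih =>
    have h2 := hp (Polynomial.X ^ j)
    rw [Finset.sum_eq_single j] at h2
    · rw [Polynomial.iterate_derivative_X_pow_eq_C_mul] at h2
      simpa [Nat.descFactorial_self, Nat.factorial_ne_zero] using h2
    · intro b _ hb
      rcases lt_or_gt_of_ne hb with hlt | hgt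
      · simp [ih b hlt]
      · rw [Polynomial.iterate_derivative_eq_zero (by simpa using hgt), zero_mul]
    · intro hj
      simp [Finsupp.notMem_support_iff.mp hj]

/-- The algebra `Ω[x]` of scalar differential operators `∑ j, ∂ ^ j F j(x)` with polynomial
coefficients. It is realized on `ℂ[x]`, where it acts
faithfully. -/
def weylAlgebra : Subalgebra ℂ RightEnd where
  carrier := {D | IsDiffOp D}
  mul_mem' := IsDiffOp.mul
  add_mem' := IsDiffOp.add
  algebraMap_mem' := isDiffOp_algebraMap

/-- The algebra `Ω[x]` as a type. -/
abbrev Omega : Type := weylAlgebra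

/-- `∂` as an element of `Ω[x]`. -/
def Omega.d : Omega := ⟨ddx, isDiffOp_ddx⟩

/-- The operator of order zero with coefficient `f`, as an element of `Ω[x]`. -/
def Omega.coef (f : ℂ[X]) : Omega := ⟨mulBy f, isDiffOp_mulBy f⟩

/-- The algebra `Mat_N(Ω[x])` of matrix differential operators with polynomial coefficients
(its rows and columns are indexed by `n`). -/
abbrev DiffOp (n : Type*) : Type _ := Matrix n n Omega

section Weights

variable {n : Type*} [Fintype n]

/-- The right action `P · D`: for `D = ∑ j, ∂ ^ j F j` it is `∑ j, P⁽ʲ⁾ F j`. -/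
def act (P : Matrix n n ℂ[X]) (D : DiffOp n) : Matrix n n ℂ[X] :=
  Matrix.of fun i j => ∑ k, (D k j).1.unop (P i k)

/-- The value `P(x)` at a real point. -/
def evalAt (P : Matrix n n ℂ[X]) (x : ℝ) : Matrix n n ℂ := P.map (Polynomial.eval (x : ℂ))

/-- The form `⟨P, Q⟩_W = ∫ P(x) W(x) Q(x)^* dx`, with entrywise integrals. A weight on an interval
is extended by zero to the real line. -/
def innerW (W : ℝ → Matrix n n ℂ) (P Q : Matrix n n ℂ[X]) : Matrix n n ℂ :=
  Matrix.of fun i j => ∫ x : ℝ, (evalAt P x * W x * (evalAt Q x)ᴴ) i j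

theorem act_mul (P : Matrix n n ℂ[X]) (D E : DiffOp n) : act P (D * E) = act (act P D) E := by
  ext1 i j
  simp only [act, Matrix.of_apply, Matrix.mul_apply, map_sum]
  rw [Finset.sum_comm]
  simp [LinearMap.sum_apply]

theorem act_add (P : Matrix n n ℂ[X]) (D E : DiffOp n) : act P (D + E) = act P D + act P E := by
  ext1 i j
  simp [act, Finset.sum_add_distrib]

theorem act_const_mul (A : Matrix n n ℂ) (P : Matrix n n ℂ[X]) (D : DiffOp n) :
    act (A.map Polynomial.C * P) D = A.map Polynomial.C * act P D := by
  ext1 i j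
  simp only [act, Matrix.of_apply, Matrix.mul_apply, Matrix.map_apply, map_sum, Finset.mul_sum,
    ← Polynomial.smul_eq_C_mul, map_smul]
  rw [Finset.sum_comm]

variable [DecidableEq n]

/-- `Q` is a sequence of orthogonal polynomials for `W`: `Q k` has degree `k` and nonsingular
leading coefficient, and different members are orthogonal. -/
structure IsOrthogonalSeq (W : ℝ → Matrix n n ℂ) (Q : ℕ → Matrix n n ℂ[X]) : Prop where
  natDegree_le : ∀ k, (matPolyEquiv (Q k)).natDegree ≤ k
  isUnit_coeff : ∀ k, IsUnit ((matPolyEquiv (Q k)).coeff k)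
  orthogonal : ∀ k l, k ≠ l → innerW W (Q k) (Q l) = 0

/-- `P` is the sequence of monic orthogonal polynomials for `W`. -/
structure IsMonicOrthogonalSeq (W : ℝ → Matrix n n ℂ) (P : ℕ → Matrix n n ℂ[X]) : Prop
    extends IsOrthogonalSeq W P where
  coeff_eq_one : ∀ k, (matPolyEquiv (P k)).coeff k = 1

theorem act_algebraMap (P : Matrix n n ℂ[X]) (c : ℂ) :
    act P (algebraMap ℂ (DiffOp n) c) = (algebraMap ℂ (Matrix n n ℂ) c).map Polynomial.C * P := by
  ext1 i j
  have key : ∀ k, ((algebraMap ℂ (DiffOp n) c) k j).1.unop (P i k)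
      = if k = j then Polynomial.C c * P i k else 0 := by
    intro k
    rw [Matrix.algebraMap_matrix_apply]
    split_ifs
    · simp [Polynomial.smul_eq_C_mul]
    · simp
  simp only [act, Matrix.of_apply, key, Matrix.mul_apply, Matrix.map_apply]
  simp [Matrix.algebraMap_matrix_apply, apply_ite Polynomial.C]

/-- The algebra `𝒟(W)` of the operators `D` in `Mat_N(Ω[x])` that have the members of every
sequence of orthogonal polynomials for `W` as eigenfunctions, `Q k · D = Λ k(D) Q k`. -/
def algD (W : ℝ → Matrix n n ℂ) : Subalgebra ℂ (DiffOp n) where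
  carrier := {D | ∀ Q, IsOrthogonalSeq W Q →
    ∀ k, ∃ L : Matrix n n ℂ, act (Q k) D = L.map Polynomial.C * Q k}
  mul_mem' := by
    intro D E hD hE Q hQ k
    obtain ⟨L, hL⟩ := hD Q hQ k
    obtain ⟨M, hM⟩ := hE Q hQ k
    refine ⟨L * M, ?_⟩
    rw [act_mul, hL, act_const_mul, hM, ← mul_assoc, Matrix.map_mul]
  add_mem' := by
    intro D E hD hE Q hQ k
    obtain ⟨L, hL⟩ := hD Q hQ k
    obtain ⟨M, hM⟩ := hE Q hQ k
    refine ⟨L + M, ?_⟩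
    rw [act_add, hL, hM, ← add_mul, Matrix.map_add _ (fun a b => Polynomial.C_add)]
  algebraMap_mem' := fun c Q _ k => ⟨algebraMap ℂ _ c, act_algebraMap (Q k) c⟩

/-- The center `𝒵(W)` of `𝒟(W)`, as a subalgebra of `Mat_N(Ω[x])`. -/
def centerD (W : ℝ → Matrix n n ℂ) : Subalgebra ℂ (DiffOp n) :=
  (Subalgebra.center ℂ (algD W)).map (algD W).val

/-- `V` preserves the degree of every matrix polynomial. -/
def IsDegreePreserving (V : DiffOp n) : Prop :=
  ∀ P : Matrix n n ℂ[X], (matPolyEquiv (act P V)).degree = (matPolyEquiv P).degree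

/-- `W'` is a Darboux transformation of `W`: some `D = V N` in `𝒟(W)`, with `V` and `N`
degree-preserving, satisfies `P k · V = A k P' k` for the monic orthogonal polynomials
`P k` of `W` and `P' k` of `W'`. -/
def IsDarbouxTransformation (W W' : ℝ → Matrix n n ℂ) : Prop :=
  ∃ V N : DiffOp n, V * N ∈ algD W ∧ IsDegreePreserving V ∧ IsDegreePreserving N ∧
    ∀ P P', IsMonicOrthogonalSeq W P → IsMonicOrthogonalSeq W' P' →
      ∀ k, ∃ A : Matrix n n ℂ, act (P k) V = A.map Polynomial.C * P' k

end Weights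

/-! ### Classical scalar weights -/

/-- The three types of classical scalar weights. -/
inductive ClassicalType
  | hermite
  | laguerre
  | jacobi

/-- A classical scalar weight, given by its type and its parameters. -/
inductive ClassicalWeight
  | hermite (b : ℝ)
  | laguerre (a : ℝ) (ha : -1 < a)
  | jacobi (a b : ℝ) (ha : -1 < a) (hb : -1 < b)

namespace ClassicalWeight

/-- The type of a classical weight. -/
def type : ClassicalWeight → ClassicalType
  | hermite _ => .hermite
  | laguerre _ _ => .laguerre
  | jacobi _ _ _ _ => .jacobi

/-- The weight function: `exp(-x² + 2bx)` on the line, `exp(-x) x ^ a` on `(0, ∞)`, or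
`(1 - x) ^ a (1 + x) ^ b` on `(-1, 1)`, extended by zero. -/
def weight : ClassicalWeight → ℝ → ℝ
  | hermite b => fun x => Real.exp (-x ^ 2 + 2 * b * x)
  | laguerre a _ => (Set.Ioi 0).indicator fun x => Real.exp (-x) * x ^ a
  | jacobi a b _ _ => (Set.Ioo (-1) 1).indicator fun x => (1 - x) ^ a * (1 + x) ^ b

/-- The second-order operator `δ` of a classical weight: `∂² - 2∂(x - b)`,
`∂² x + ∂(a + 1 - x)`, or `∂² (1 - x²) + ∂(b - a - x(a + b + 2))`. -/
def delta : ClassicalWeight → Omega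
  | hermite b =>
      Omega.d ^ 2 - 2 * (Omega.d * Omega.coef (Polynomial.X - Polynomial.C (b : ℂ)))
  | laguerre a _ =>
      Omega.d ^ 2 * Omega.coef Polynomial.X
        + Omega.d * Omega.coef (Polynomial.C ((a : ℂ) + 1) - Polynomial.X)
  | jacobi a b _ _ =>
      Omega.d ^ 2 * Omega.coef (1 - Polynomial.X ^ 2)
        + Omega.d * Omega.coef (Polynomial.C ((b : ℂ) - a)
            - Polynomial.X * Polynomial.C ((a : ℂ) + b + 2))

end ClassicalWeight

/-- The direct sum `w₁ ⊕ ⋯ ⊕ w_k` of classical scalar weights, a diagonal weight matrix. -/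
def diagWeight {n : Type*} [DecidableEq n] (w : n → ClassicalWeight) : ℝ → Matrix n n ℂ :=
  fun x => Matrix.diagonal fun j => ((w j).weight x : ℂ)

/-- Darboux equivalence of classical scalar weights, seen as weight matrices of size one. -/
def DarbouxEquiv (v w : ClassicalWeight) : Prop :=
  IsDarbouxTransformation (diagWeight fun _ : Fin 1 => v) (diagWeight fun _ : Fin 1 => w)

/-- The diagonal operator `Δ = diag(δ₁, …, δ_k)`. -/
def diagDelta {n : Type*} [DecidableEq n] (w : n → ClassicalWeight) : DiffOp n :=
  Matrix.diagonal fun j => (w j).delta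

/-- The direct sum `W₁ ⊕ ⋯ ⊕ W_m` of weight matrices, a block diagonal weight matrix. -/
def directSumWeight {m : ℕ} {k : Fin m → ℕ} (W : ∀ i, ℝ → Matrix (Fin (k i)) (Fin (k i)) ℂ) :
    ℝ → Matrix (Σ i, Fin (k i)) (Σ i, Fin (k i)) ℂ :=
  fun x => Matrix.blockDiagonal' fun i => W i x

/-- The direct sum `A₁ ⊕ ⋯ ⊕ A_m` of algebras of matrix differential operators: the block diagonal
operators whose `i`-th block lies in `A i`. -/
def directSumAlg {m : ℕ} {k : Fin m → ℕ} (A : ∀ i, Subalgebra ℂ (DiffOp (Fin (k i)))) :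
    Subalgebra ℂ (DiffOp (Σ i, Fin (k i))) where
  carrier := {D | ∃ M : ∀ i, DiffOp (Fin (k i)), (∀ i, M i ∈ A i) ∧ D = Matrix.blockDiagonal' M}
  mul_mem' := by
    rintro _ _ ⟨M, hM, rfl⟩ ⟨N, hN, rfl⟩
    exact ⟨fun i => M i * N i, fun i => mul_mem (hM i) (hN i),
      (Matrix.blockDiagonal'_mul M N).symm⟩
  add_mem' := by
    rintro _ _ ⟨M, hM, rfl⟩ ⟨N, hN, rfl⟩
    exact ⟨M + N, fun i => add_mem (hM i) (hN i), (Matrix.blockDiagonal'_add M N).symm⟩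
  algebraMap_mem' := by
    intro c
    refine ⟨fun i => algebraMap ℂ _ c, fun i => (A i).algebraMap_mem c, ?_⟩
    rw [Algebra.algebraMap_eq_smul_one, ← Matrix.blockDiagonal'_one, ← Matrix.blockDiagonal'_smul]
    congr 1
    funext i
    rw [Algebra.algebraMap_eq_smul_one]
    rfl

end MVOP

end

noncomputable section

namespace MVOP

open Polynomial

/-! ### Commutators with multiplication by `x` -/

/-! The problem reduces to scalar operators. A matrix operator `D` lies in the algebra of a diagonal
weight exactly when each entry `D i j` sends the `n`-th orthogonal polynomial of `w i` to a multiple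
of that of `w j` (`mem_algD_diagWeight_iff`). Entries are thus morphisms between scalar weights
(`IsHom`), and three facts about them determine the center.

Endomorphisms of one weight are polynomials in its second-order operator δ (`IsHom.exists_aeval`).
For Hermite and Laguerre, eigenvalues of a differential operator are polynomial in `n`, and those of
δ are linear in `n`. For Jacobi, the principal symbol must be a multiple of `(1 - x²)^m`, so
subtracting a multiple of `δ^m` lowers the order.

A nonzero morphism between weights of the same type forces equal δ-eigenvalues (`IsHom.eig_eq`),
hence intertwines the two operators δ. The only real case is Jacobi, where `a + b` must be preserved
(`IsHom.add_eq_add`).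

A nonzero morphism moreover forces Darboux equivalence (`IsHom.linked`). Intertwining gives a
first-order equation for the principal symbol (`symbol_equation`). Its polynomial solutions exist
only if the parameters agree (Hermite) or differ by integers, and contiguity relations realize these
shifts. Darboux equivalence itself means a morphism with no zero eigenvalue
(`darbouxEquiv_iff_linked`), the second factor being a formal adjoint.

Now a central operator commutes with the diagonal matrix units, so it is `diag(p i (δ i))`;
commuting with a link from `i` to `j` forces `p i = p j` at infinitely many eigenvalues. Conversely,
such operators are central when `p` is constant on equivalence classes, since nonzero entries only
join equivalent weights. The blocks are the classes, so one polynomial may be chosen freely per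
block. -/

/-- Linear endomorphisms of `ℂ[x]`, multiplied by composition. -/
abbrev PolyEnd : Type := Module.End ℂ ℂ[X]

/-- Multiplication by `f`, as an endomorphism. -/
abbrev mulEnd (f : ℂ[X]) : PolyEnd := LinearMap.mulRight ℂ f

/-- The commutator `T ↦ T x - x T`. -/
def theta : Module.End ℂ PolyEnd :=
  LinearMap.mulRight ℂ (mulEnd X) - LinearMap.mulLeft ℂ (mulEnd X)

theorem theta_apply (T : PolyEnd) : theta T = T * mulEnd X - mulEnd X * T := rfl

theorem theta_apply_apply (T : PolyEnd) (p : ℂ[X]) : theta T p = T (p * X) - T p * X := rfl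

theorem theta_pow_succ (k : ℕ) (T : PolyEnd) : (theta ^ (k + 1)) T = (theta ^ k) (theta T) := by
  rw [pow_succ]; rfl

theorem theta_pow_succ' (k : ℕ) (T : PolyEnd) : (theta ^ (k + 1)) T = theta ((theta ^ k) T) := by
  rw [pow_succ']; rfl

theorem theta_mul (S T : PolyEnd) : theta (S * T) = theta S * T + S * theta T := by
  simp only [theta_apply, sub_mul, mul_sub, mul_assoc]
  abel

theorem theta_mulEnd (f : ℂ[X]) : theta (mulEnd f) = 0 := by
  refine LinearMap.ext fun p => ?_
  simp [theta_apply_apply]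
  ring

/-- `theta` is a derivation for composition, so its powers obey the general Leibniz rule. -/
theorem theta_pow_mul (n : ℕ) (S T : PolyEnd) :
    (theta ^ n) (S * T) = ∑ ij ∈ Finset.HasAntidiagonal.antidiagonal n,
      n.choose ij.1 • ((theta ^ ij.1) S * (theta ^ ij.2) T) := by
  induction n with
  | zero => simp
  | succ n ih =>
    rw [Finset.sum_antidiagonal_choose_succ_nsmul
      (fun i j => (theta ^ i) S * (theta ^ j) T) n, theta_pow_succ', ih]
    simp only [map_sum, map_nsmul, theta_mul, smul_add, Finset.sum_add_distrib, theta_pow_succ']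
    rw [add_comm]
    congr 1
    refine Finset.sum_congr rfl fun ⟨i, j⟩ hij => ?_
    rw [n.choose_symm_of_eq_add (Finset.HasAntidiagonal.mem_antidiagonal.1 hij).symm]

theorem theta_pow_eq_zero_of_le {T : PolyEnd} {k l : ℕ} (h : (theta ^ k) T = 0) (hkl : k ≤ l) :
    (theta ^ l) T = 0 := by
  obtain ⟨m, rfl⟩ := Nat.exists_eq_add_of_le' hkl
  rw [pow_add, Module.End.mul_apply, h, map_zero]

/-- The principal symbol is multiplicative. -/
theorem theta_pow_mul_top {S T : PolyEnd} {k l : ℕ} (hS : (theta ^ (k + 1)) S = 0)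
    (hT : (theta ^ (l + 1)) T = 0) :
    (theta ^ (k + l)) (S * T) = (k + l).choose k • ((theta ^ k) S * (theta ^ l) T) := by
  rw [theta_pow_mul, Finset.sum_eq_single (k, l)]
  · rintro ⟨i, j⟩ hij hne
    have hij' : i + j = k + l := Finset.HasAntidiagonal.mem_antidiagonal.1 hij
    rcases lt_trichotomy i k with h | h | h
    · have : l + 1 ≤ j := by omega
      simp [theta_pow_eq_zero_of_le hT this]
    · exact absurd (Prod.ext h (by simp; omega)) hne
    · simp [theta_pow_eq_zero_of_le hS h]
  · intro h; simp at h

theorem theta_pow_mul_eq_zero {S T : PolyEnd} {k l : ℕ} (hS : (theta ^ (k + 1)) S = 0)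
    (hT : (theta ^ (l + 1)) T = 0) : (theta ^ (k + l + 1)) (S * T) = 0 := by
  rw [theta_pow_mul]
  refine Finset.sum_eq_zero ?_
  rintro ⟨i, j⟩ hij
  have hij' : i + j = k + l + 1 := Finset.HasAntidiagonal.mem_antidiagonal.1 hij
  rcases le_or_gt i k with h | h
  · simp [theta_pow_eq_zero_of_le hT (show l + 1 ≤ j by omega)]
  · simp [theta_pow_eq_zero_of_le hS h]

/-- An endomorphism that commutes with `x` is a multiplication operator. -/
theorem eq_mulEnd_of_theta_eq_zero {T : PolyEnd} (h : theta T = 0) : T = mulEnd (T 1) := by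
  have h1 : ∀ p, T (p * X) = T p * X := fun p => by
    have := congrArg (fun S : PolyEnd => S p) h
    simpa [theta_apply_apply, sub_eq_zero] using this
  have h2 : ∀ n : ℕ, T (X ^ n) = X ^ n * T 1 := by
    intro n
    induction n with
    | zero => simp
    | succ n ih => rw [pow_succ, h1, ih]; ring
  refine Polynomial.lhom_ext' fun n => LinearMap.ext_ring ?_
  simp [monomial_one_right_eq_X_pow, h2]

/-- The polynomial `f` serves as principal symbol throughout: it is `k!` times the coefficient of `∂
^ k`. -/
theorem exists_mulEnd_of_theta_pow {T : PolyEnd} {k : ℕ} (h : (theta ^ (k + 1)) T = 0) :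
    ∃ f, (theta ^ k) T = mulEnd f :=
  ⟨_, eq_mulEnd_of_theta_eq_zero (by rw [← theta_pow_succ', h])⟩

/-! ### Operators of finite order -/

/-- Endomorphisms of `ℂ[x]` that are differential operators with polynomial coefficients. -/
def IsFiniteOrder (T : PolyEnd) : Prop := ∃ k, (theta ^ k) T = 0

theorem mulEnd_injective {f g : ℂ[X]} (h : mulEnd f = mulEnd g) : f = g := by
  simpa using congrArg (fun S : PolyEnd => S 1) h

theorem mulEnd_zero : mulEnd 0 = 0 := by
  refine LinearMap.ext fun p => ?_
  simp

theorem mulEnd_mul_mulEnd (f g : ℂ[X]) : mulEnd f * mulEnd g = mulEnd (f * g) := by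
  refine LinearMap.ext fun p => ?_
  simp
  ring

/-- A nonzero operator of finite order has an order and a nonzero principal symbol. -/
theorem IsFiniteOrder.exists_order {T : PolyEnd} (hT : IsFiniteOrder T) (h0 : T ≠ 0) :
    ∃ k f, (theta ^ (k + 1)) T = 0 ∧ (theta ^ k) T = mulEnd f ∧ f ≠ 0 := by
  classical
  have hex : ∃ k, (theta ^ k) T = 0 := hT
  obtain ⟨k, hk⟩ : ∃ k, Nat.find hex = k + 1 := by
    refine Nat.exists_eq_succ_of_ne_zero fun h => h0 ?_
    have := Nat.find_spec hex
    rw [h] at this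
    simpa using this
  have h1 : (theta ^ (k + 1)) T = 0 := hk ▸ Nat.find_spec hex
  obtain ⟨f, hf⟩ := exists_mulEnd_of_theta_pow h1
  refine ⟨k, f, h1, hf, ?_⟩
  rintro rfl
  refine Nat.find_min hex (m := k) (by omega) ?_
  rw [hf, mulEnd_zero]

theorem IsFiniteOrder.mul {S T : PolyEnd} (hS : IsFiniteOrder S) (hT : IsFiniteOrder T) :
    IsFiniteOrder (S * T) := by
  obtain ⟨k, hk⟩ := hS
  obtain ⟨l, hl⟩ := hT
  exact ⟨k + l + 1, theta_pow_mul_eq_zero (theta_pow_eq_zero_of_le hk (by omega))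
    (theta_pow_eq_zero_of_le hl (by omega))⟩

theorem IsFiniteOrder.add {S T : PolyEnd} (hS : IsFiniteOrder S) (hT : IsFiniteOrder T) :
    IsFiniteOrder (S + T) := by
  obtain ⟨k, hk⟩ := hS
  obtain ⟨l, hl⟩ := hT
  exact ⟨k + l, by rw [map_add, theta_pow_eq_zero_of_le hk (by omega),
    theta_pow_eq_zero_of_le hl (by omega), add_zero]⟩

theorem IsFiniteOrder.smul {S : PolyEnd} (hS : IsFiniteOrder S) (c : ℂ) :
    IsFiniteOrder (c • S) := by
  obtain ⟨k, hk⟩ := hS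
  exact ⟨k, by rw [map_smul, hk, smul_zero]⟩

theorem IsFiniteOrder.sub {S T : PolyEnd} (hS : IsFiniteOrder S) (hT : IsFiniteOrder T) :
    IsFiniteOrder (S - T) := by
  rw [sub_eq_add_neg, ← neg_one_smul ℂ]
  exact hS.add (hT.smul (-1))

theorem isFiniteOrder_mulEnd (f : ℂ[X]) : IsFiniteOrder (mulEnd f) :=
  ⟨1, by simpa using theta_mulEnd f⟩

theorem theta_derivative : theta (derivative : PolyEnd) = 1 := by
  refine LinearMap.ext fun p => ?_
  simp [theta_apply_apply]

theorem isFiniteOrder_derivative : IsFiniteOrder (derivative : PolyEnd) := by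
  refine ⟨2, ?_⟩
  rw [theta_pow_succ', pow_one, theta_derivative]
  simp [theta_apply]

theorem isFiniteOrder_one : IsFiniteOrder 1 := ⟨1, by simp [theta_apply]⟩

theorem IsFiniteOrder.pow {S : PolyEnd} (hS : IsFiniteOrder S) (n : ℕ) :
    IsFiniteOrder (S ^ n) := by
  induction n with
  | zero => simpa using isFiniteOrder_one
  | succ n ih => rw [pow_succ]; exact ih.mul hS

theorem IsFiniteOrder.aeval {S : PolyEnd} (hS : IsFiniteOrder S) (q : ℂ[X]) :
    IsFiniteOrder (aeval S q) := by
  induction q using Polynomial.induction_on' with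
  | add p q hp hq => rw [map_add]; exact hp.add hq
  | monomial n c =>
    rw [aeval_monomial, ← Algebra.smul_def]
    exact (hS.pow n).smul c

theorem theta_derivative_pow (n : ℕ) :
    theta ((derivative : PolyEnd) ^ (n + 1)) = (n + 1) • (derivative : PolyEnd) ^ n := by
  induction n with
  | zero => simp [theta_derivative]
  | succ n ih =>
    rw [pow_succ, theta_mul, ih, theta_derivative, mul_one, smul_mul_assoc,
      ← pow_succ, ← succ_nsmul]

theorem theta_pow_derivative_pow (n : ℕ) :
    (theta ^ n) ((derivative : PolyEnd) ^ n) = n.factorial • 1 := by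
  induction n with
  | zero => simp
  | succ n ih =>
    rw [theta_pow_succ, theta_derivative_pow, map_nsmul, ih, smul_smul, Nat.factorial_succ]

theorem theta_pow_mulEnd_mul (f : ℂ[X]) (n : ℕ) (T : PolyEnd) :
    (theta ^ n) (mulEnd f * T) = mulEnd f * (theta ^ n) T := by
  induction n generalizing T with
  | zero => simp
  | succ n ih => rw [theta_pow_succ, theta_mul, theta_mulEnd, zero_mul, zero_add, ih,
      ← theta_pow_succ]

/-- Grothendieck's description of differential operators. Conversely to the easy direction, if
`theta ^ k` turns `T` into multiplication by `f`, then subtracting `(f / k!) ∂ ^ k` lowers the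
order. -/
theorem isDiffOp_op_iff (T : PolyEnd) : IsDiffOp (MulOpposite.op T) ↔ IsFiniteOrder T := by
  constructor
  · rintro ⟨F, hF⟩
    have : T = F.sum fun j f => mulEnd f * (derivative : PolyEnd) ^ j := by
      apply MulOpposite.op_injective
      rw [hF, Finsupp.sum, Finsupp.sum, Finset.op_sum]
      rfl
    rw [this, Finsupp.sum]
    refine Finset.sum_induction _ IsFiniteOrder (fun _ _ => IsFiniteOrder.add) ⟨0, by simp⟩ ?_
    exact fun j _ => (isFiniteOrder_mulEnd _).mul (isFiniteOrder_derivative.pow j)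
  · rintro ⟨k, hk⟩
    induction k generalizing T with
    | zero =>
      obtain rfl : T = 0 := by simpa using hk
      exact isDiffOp_zero
    | succ k ih =>
      obtain ⟨f, hf⟩ := exists_mulEnd_of_theta_pow hk
      have h1 : IsDiffOp (MulOpposite.op
          (mulEnd ((k.factorial : ℂ)⁻¹ • f) * (derivative : PolyEnd) ^ k)) :=
        isDiffOp_monomial k ((k.factorial : ℂ)⁻¹ • f)
      have h2 := ih (T - mulEnd ((k.factorial : ℂ)⁻¹ • f) * (derivative : PolyEnd) ^ k) (by
        rw [map_sub, hf, theta_pow_mulEnd_mul, theta_pow_derivative_pow, sub_eq_zero]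
        refine LinearMap.ext fun p => ?_
        have : (k.factorial : ℂ) ≠ 0 := by exact_mod_cast k.factorial_ne_zero
        simp [smul_smul, ← Nat.cast_smul_eq_nsmul ℂ, this])
      simpa using h2.add h1

theorem isFiniteOrder_unop (D : Omega) : IsFiniteOrder D.1.unop :=
  (isDiffOp_op_iff _).1 D.2

/-- The coefficient of `x ^ n` in `x ^ n · D` is polynomial in `n`. -/
theorem IsDiffOp.exists_eigenvalue_polynomial {D : RightEnd} (hD : IsDiffOp D) :
    ∃ q : ℂ[X], ∀ n : ℕ, (D.unop (X ^ n)).coeff n = q.eval (n : ℂ) := by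
  obtain ⟨F, rfl⟩ := hD
  refine Finset.sum_induction (fun j => ddx ^ j * mulBy (F j))
    (fun D : RightEnd => ∃ q : ℂ[X], ∀ n : ℕ, (D.unop (X ^ n)).coeff n = q.eval (n : ℂ)) ?_ ?_ ?_
  · rintro A B ⟨q, hq⟩ ⟨r, hr⟩
    exact ⟨q + r, fun n => by simp [hq, hr]⟩
  · exact ⟨0, by simp⟩
  · intro j _
    refine ⟨C ((F j).coeff j) * descPochhammer ℂ j, fun n => ?_⟩
    have h1 : (ddx ^ j * mulBy (F j)).unop (X ^ n)
        = derivative^[j] (X ^ n : ℂ[X]) * F j := by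
      rw [← Module.End.pow_apply]; rfl
    rw [h1, Polynomial.iterate_derivative_X_pow_eq_C_mul, eval_mul, eval_C,
      descPochhammer_eval_eq_descFactorial, mul_assoc, coeff_C_mul]
    -- For `j ≤ n` only the coefficient of `x ^ j` in `F j` reaches degree `n`; for `j > n` the
    -- descending factorial vanishes.
    rcases le_or_gt j n with h | h
    · obtain ⟨m, rfl⟩ := Nat.exists_eq_add_of_le h
      rw [Nat.add_sub_cancel_left, coeff_X_pow_mul, mul_comm]
    · simp [Nat.descFactorial_of_lt h]

/-! ### Orthogonal polynomials for a definite Hermitian form -/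

/-- Sesquilinear forms on `ℂ[x]`. -/
abbrev PolyForm : Type := ℂ[X] →ₗ[ℂ] ℂ[X] →ₗ⋆[ℂ] ℂ

/-- The form is Hermitian and anisotropic, and multiplication by `x` is symmetric for it. -/
structure IsPolyInner (S : PolyForm) : Prop where
  conj_symm : ∀ p q, starRingEnd ℂ (S p q) = S q p
  definite : ∀ p, S p p = 0 → p = 0
  mul_X : ∀ p q, S (p * X) q = S p (q * X)

/-- `P` is the sequence of monic orthogonal polynomials of the form `S`. -/
structure IsOPS (S : PolyForm) (P : ℕ → ℂ[X]) : Prop where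
  monic : ∀ n, (P n).Monic
  natDegree_eq : ∀ n, (P n).natDegree = n
  orthogonal : ∀ m n, m ≠ n → S (P m) (P n) = 0

theorem natDegree_sub_smul_lt {p q : ℂ[X]} {n : ℕ} (hq : q.Monic) (hn : q.natDegree = n)
    (hp : p.natDegree ≤ n) : (p - p.coeff n • q).degree < n := by
  rw [degree_lt_iff_coeff_zero]
  intro m hm
  rcases hm.eq_or_lt with rfl | h
  · have : q.coeff n = 1 := by rw [← hn]; exact hq
    simp [this]
  · simp [coeff_eq_zero_of_natDegree_lt (hp.trans_lt h),
      coeff_eq_zero_of_natDegree_lt (hn.trans_lt h)]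

theorem natDegree_le_of_degree_lt_succ {r : ℂ[X]} {k : ℕ} (hr : r.degree < (k + 1 : ℕ)) :
    r.natDegree ≤ k := by
  rw [degree_lt_iff_coeff_zero] at hr
  exact natDegree_le_iff_coeff_eq_zero.2 fun m hm => hr m hm

/-- Induction over the polynomials of degree less than `n` along monic polynomials of each
degree. -/
theorem degree_lt_induction {P : ℕ → ℂ[X]} {n : ℕ} (hm : ∀ m < n, (P m).Monic)
    (hd : ∀ m < n, (P m).natDegree = m) {C : ℂ[X] → Prop} (h0 : C 0)
    (hadd : ∀ m < n, ∀ (c : ℂ) (r : ℂ[X]), C r → C (r + c • P m)) :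
    ∀ r : ℂ[X], r.degree < n → C r := by
  have key : ∀ k ≤ n, ∀ r : ℂ[X], r.degree < k → C r := by
    intro k
    induction k with
    | zero =>
      intro _ r hr
      have : r = 0 := by
        rw [← degree_eq_bot]
        exact Nat.WithBot.lt_zero_iff.1 (by simpa using hr)
      rwa [this]
    | succ k ih =>
      intro hk r hr
      have h1 : r.natDegree ≤ k := natDegree_le_of_degree_lt_succ hr
      have h2 := ih (by omega) _ (natDegree_sub_smul_lt (hm k hk) (hd k hk) h1)
      simpa using hadd k hk (r.coeff k) _ h2
  exact key n le_rfl

section Forms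

variable {S S' : PolyForm} {P Q : ℕ → ℂ[X]}

theorem IsPolyInner.symm_zero (hS : IsPolyInner S) {p q : ℂ[X]} (h : S p q = 0) : S q p = 0 := by
  rw [← hS.conj_symm, h, map_zero]

theorem IsOPS.orthogonal_of_degree_lt (hP : IsOPS S P) {n : ℕ} {r : ℂ[X]} (hr : r.degree < n) :
    S (P n) r = 0 := by
  refine degree_lt_induction (P := P) (n := n) (C := fun r => S (P n) r = 0)
    (fun m _ => hP.monic m) (fun m _ => hP.natDegree_eq m) (by simp) ?_ r hr
  intro m hm c r hr
  simp [hr, hP.orthogonal n m hm.ne']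

/-- Gram–Schmidt on the monomials; anisotropy makes the denominators nonzero. -/
theorem IsPolyInner.exists_isOPS (hS : IsPolyInner S) : ∃ P, IsOPS S P := by
  have key : ∀ n : ℕ, ∃ q : ℂ[X], q.Monic ∧ q.natDegree = n ∧
      ∀ r : ℂ[X], r.degree < n → S q r = 0 := by
    intro n
    induction n using Nat.strong_induction_on with
    | _ n ih =>
      choose! P hm hd ho using ih
      have horth : ∀ i < n, ∀ j < n, i ≠ j → S (P i) (P j) = 0 := by
        intro i hi j hj hij
        rcases lt_or_gt_of_ne hij with h | h
        · refine hS.symm_zero (ho j hj _ ?_)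
          rw [degree_eq_natDegree (hm i hi).ne_zero, hd i hi]
          exact_mod_cast h
        · refine ho i hi _ ?_
          rw [degree_eq_natDegree (hm j hj).ne_zero, hd j hj]
          exact_mod_cast h
      set s : ℂ[X] := ∑ m ∈ Finset.range n, (S (X ^ n) (P m) / S (P m) (P m)) • P m with hs
      have hsdeg : s.degree < n := by
        rw [degree_lt_iff_coeff_zero]
        intro k hk
        rw [hs, finsetSum_coeff]
        refine Finset.sum_eq_zero fun m hm' => ?_
        have hmn := Finset.mem_range.1 hm'
        rw [coeff_smul, coeff_eq_zero_of_natDegree_lt (by rw [hd m hmn]; omega), smul_zero]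
      have hmon : (X ^ n - s).Monic := monic_X_pow_sub (by exact hsdeg)
      have hdeg : (X ^ n - s).degree = (n : WithBot ℕ) := by
        rw [degree_sub_eq_left_of_degree_lt (by rwa [degree_X_pow]), degree_X_pow]
      refine ⟨X ^ n - s, hmon, natDegree_eq_of_degree_eq_some hdeg, ?_⟩
      refine degree_lt_induction (P := P) hm hd (by simp) ?_
      intro m hmn c r hr
      have h1 : S s (P m) = S (X ^ n) (P m) := by
        rw [hs, map_sum, LinearMap.sum_apply, Finset.sum_eq_single m]
        · have : S (P m) (P m) ≠ 0 := fun h => (hm m hmn).ne_zero (hS.definite _ h)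
          simp [this]
        · intro j hj hjm
          simp [horth j (Finset.mem_range.1 hj) m hmn hjm]
        · intro h
          exact absurd (Finset.mem_range.2 hmn) h
      rw [map_add, hr, LinearMap.map_smulₛₗ, map_sub, LinearMap.sub_apply, h1]
      simp
  choose P hm hd ho using key
  refine ⟨P, hm, hd, fun i j hij => ?_⟩
  rcases lt_or_gt_of_ne hij with h | h
  · refine hS.symm_zero (ho j _ ?_)
    rw [degree_eq_natDegree (hm i).ne_zero, hd i]
    exact_mod_cast h
  · refine ho i _ ?_
    rw [degree_eq_natDegree (hm j).ne_zero, hd j]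
    exact_mod_cast h

/-- A polynomial of degree at most `n` that is orthogonal to all polynomials of smaller degree
is a multiple of the `n`-th orthogonal polynomial. -/
theorem IsOPS.eq_smul (hS : IsPolyInner S) (hP : IsOPS S P) {n : ℕ} {q : ℂ[X]}
    (hq : q.natDegree ≤ n) (ho : ∀ r : ℂ[X], r.degree < n → S q r = 0) :
    q = q.coeff n • P n := by
  have h1 := natDegree_sub_smul_lt (hP.monic n) (hP.natDegree_eq n) hq
  rw [← sub_eq_zero]
  -- The difference has degree below `n` and is orthogonal to all such polynomials, hence to itself.
  apply hS.definite
  have h2 : ∀ r, S (q - q.coeff n • P n) r = S q r - q.coeff n * S (P n) r := fun r => by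
    rw [map_sub, map_smul, LinearMap.sub_apply, LinearMap.smul_apply, smul_eq_mul]
  rw [h2, ho _ h1, hP.orthogonal_of_degree_lt h1, mul_zero, sub_zero]

/-- The orthogonal polynomials as a basis of `ℂ[x]`. -/
def IsOPS.basis (hP : IsOPS S P) : Module.Basis ℕ ℂ ℂ[X] :=
  Polynomial.Sequence.basis
    ⟨P, fun n => by rw [degree_eq_natDegree (hP.monic n).ne_zero, hP.natDegree_eq n]⟩
    fun n => by
      have : (P n).leadingCoeff = 1 := hP.monic n
      simp [this]

@[simp] theorem IsOPS.basis_apply (hP : IsOPS S P) (n : ℕ) : hP.basis n = P n :=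
  Polynomial.Sequence.basis_eq_self _ _ n

theorem IsOPS.end_ext (hP : IsOPS S P) {T U : PolyEnd} (h : ∀ n, T (P n) = U (P n)) : T = U :=
  hP.basis.ext fun n => by simpa using h n

theorem IsOPS.ne_zero (hP : IsOPS S P) (n : ℕ) : P n ≠ 0 := (hP.monic n).ne_zero

theorem IsOPS.coeff_self (hP : IsOPS S P) (n : ℕ) : (P n).coeff n = 1 := by
  have := hP.monic n
  rwa [Monic, leadingCoeff, hP.natDegree_eq] at this

/-- An eigenvector of an operator that is diagonal with distinct eigenvalues on the orthogonal
polynomials is a multiple of an orthogonal polynomial. -/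
theorem IsOPS.eq_smul_of_eigen (hP : IsOPS S P) {T : PolyEnd} {g : ℕ → ℂ}
    (hT : ∀ n, T (P n) = g n • P n) (hg : Function.Injective g) {n : ℕ} {q : ℂ[X]}
    (hq : T q = g n • q) : ∃ c : ℂ, q = c • P n := by
  have h1 : ∀ (p : ℂ[X]) (m : ℕ), hP.basis.repr (T p) m = g m * hP.basis.repr p m := by
    intro p m
    have : (Finsupp.lapply m ∘ₗ hP.basis.repr.toLinearMap ∘ₗ T : ℂ[X] →ₗ[ℂ] ℂ)
        = g m • (Finsupp.lapply m ∘ₗ hP.basis.repr.toLinearMap) := by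
      refine hP.basis.ext fun k => ?_
      simp only [LinearMap.comp_apply, LinearMap.smul_apply, hP.basis_apply, hT, map_smul]
      rw [← hP.basis_apply k]
      simp only [LinearEquiv.coe_coe, Module.Basis.repr_self, Finsupp.lapply_apply, smul_eq_mul]
      rcases eq_or_ne k m with rfl | h
      · rfl
      · simp [h]
    exact congrArg (fun f : ℂ[X] →ₗ[ℂ] ℂ => f p) this
  refine ⟨hP.basis.repr q n, ?_⟩
  apply hP.basis.repr.injective
  ext m
  rw [← hP.basis_apply n, map_smul, Module.Basis.repr_self]
  rcases eq_or_ne m n with rfl | h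
  · simp
  · have h2 := h1 q m
    rw [hq, map_smul, Finsupp.smul_apply, smul_eq_mul] at h2
    have h3 : g n ≠ g m := fun h' => h (hg h').symm
    have h4 : (g n - g m) * hP.basis.repr q m = 0 := by rw [sub_mul, h2, sub_self]
    have h5 := (mul_eq_zero.1 h4).resolve_left (sub_ne_zero.2 h3)
    simp [h5, h.symm]

/-- An operator that does not raise degrees and that is symmetric for the form is diagonal on the
orthogonal polynomials. -/
theorem IsOPS.eigen_of_symmetric (hS : IsPolyInner S) (hP : IsOPS S P) {T : PolyEnd}
    (hT : ∀ p q, S (T p) q = S p (T q))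
    (hdeg : ∀ (n : ℕ) (p : ℂ[X]), p.degree < n → (T p).degree < n)
    (n : ℕ) : T (P n) = (T (P n)).coeff n • P n := by
  refine hP.eq_smul hS ?_ fun r hr => ?_
  · have := hdeg (n + 1) (P n) (by
      rw [degree_eq_natDegree (hP.ne_zero n), hP.natDegree_eq]; exact_mod_cast n.lt_succ_self)
    exact natDegree_le_of_degree_lt_succ this
  · rw [hT]
    exact hP.orthogonal_of_degree_lt (hdeg n r hr)

/-! ### Adjoints -/

/-- Multiplication by `x` is symmetric for both forms, so taking adjoints changes the sign of the
commutator with `x`. Iterating shows that adjoints of operators of finite order have finite order.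
-/
theorem theta_adjoint (hS : IsPolyInner S) (hS' : IsPolyInner S') {V U : PolyEnd}
    (h : ∀ f g, S' (V f) g = S f (U g)) (f g : ℂ[X]) :
    S' (theta V f) g = S f ((-theta U) g) := by
  rw [theta_apply_apply, LinearMap.neg_apply, theta_apply_apply, map_sub, map_neg, map_sub,
    LinearMap.sub_apply, hS'.mul_X, h, h, hS.mul_X]
  ring

theorem isFiniteOrder_of_adjoint (hS : IsPolyInner S) (hS' : IsPolyInner S') {V U : PolyEnd}
    (h : ∀ f g, S' (V f) g = S f (U g)) (hV : IsFiniteOrder V) : IsFiniteOrder U := by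
  obtain ⟨k, hk⟩ := hV
  induction k generalizing V U with
  | zero =>
    refine ⟨0, ?_⟩
    have hV0 : V = 0 := by simpa using hk
    refine LinearMap.ext fun g => hS.definite _ ?_
    rw [pow_zero, Module.End.one_apply, ← h, hV0]
    simp
  | succ k ih =>
    obtain ⟨l, hl⟩ := ih (theta_adjoint hS hS' h) hk
    exact ⟨l + 1, by rw [theta_pow_succ]; simpa using hl⟩

/-- The adjoint of an operator of finite order that maps the orthogonal polynomials of one form
to multiples of those of another one. -/
theorem IsOPS.exists_adjoint (hS : IsPolyInner S) (hS' : IsPolyInner S') (hP : IsOPS S P)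
    (hQ : IsOPS S' Q) {V : PolyEnd} (hV : IsFiniteOrder V) {c : ℕ → ℂ}
    (hc : ∀ n, V (P n) = c n • Q n) :
    ∃ (U : PolyEnd) (d : ℕ → ℂ), IsFiniteOrder U ∧ (∀ n, U (Q n) = d n • P n) ∧
      ∀ n, d n = 0 ↔ c n = 0 := by
  -- The value forced by `S' (V (P n)) (Q n) = S (P n) (U (Q n))`; the conjugate appears because the
  -- forms are conjugate-linear on the right.
  set d : ℕ → ℂ := fun n => starRingEnd ℂ (c n * S' (Q n) (Q n) / S (P n) (P n)) with hd
  have hP0 : ∀ n, S (P n) (P n) ≠ 0 := fun n h => hP.ne_zero n (hS.definite _ h)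
  have hQ0 : ∀ n, S' (Q n) (Q n) ≠ 0 := fun n h => hQ.ne_zero n (hS'.definite _ h)
  set U : PolyEnd := hQ.basis.constr ℂ fun n => d n • P n with hU
  have hUQ : ∀ n, U (Q n) = d n • P n := fun n => by
    rw [hU, ← hQ.basis_apply n, Module.Basis.constr_basis]
  have hadj : ∀ f g, S' (V f) g = S f (U g) := by
    intro f g
    have hA : S' ∘ₗ V = (LinearMap.compl₂ S U : PolyForm) := by
      refine hP.basis.ext fun m => ?_
      refine hQ.basis.ext fun n => ?_
      simp only [LinearMap.comp_apply, hP.basis_apply, hQ.basis_apply, hc, map_smul,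
        LinearMap.smul_apply, LinearMap.compl₂_apply, hUQ,
        LinearMap.map_smulₛₗ]
      rcases eq_or_ne m n with rfl | h
      · simp only [hd, RingHomCompTriple.comp_apply, smul_eq_mul, RingHom.id_apply]
        rw [div_mul_cancel₀ _ (hP0 m)]
      · simp [hP.orthogonal m n h, hQ.orthogonal m n h]
    exact congrArg (fun F : PolyForm => F f g) hA
  refine ⟨U, d, isFiniteOrder_of_adjoint hS hS' hadj hV, hUQ, fun n => ?_⟩
  simp [hd, hP0 n, hQ0 n]

end Forms

section Moments

open MeasureTheory Set Filter Topology

/-! ### Moments of the classical weights -/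

theorem integrable_eval_mul {g : ℝ → ℝ} (h : ∀ n : ℕ, Integrable fun x => x ^ n * g x) (r : ℂ[X]) :
    Integrable fun x : ℝ => r.eval (x : ℂ) * (g x : ℂ) := by
  have : (fun x : ℝ => r.eval (x : ℂ) * (g x : ℂ)) = fun x : ℝ =>
      ∑ i ∈ Finset.range (r.natDegree + 1), r.coeff i * ((x ^ i * g x : ℝ) : ℂ) := by
    funext x
    rw [eval_eq_sum_range, Finset.sum_mul]
    refine Finset.sum_congr rfl fun i _ => ?_
    push_cast
    ring
  rw [this]
  exact integrable_finsetSum _ fun i _ => (h i).ofReal.const_mul _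

theorem hasDerivAt_eval_ofReal (q : ℂ[X]) (x : ℝ) :
    HasDerivAt (fun y : ℝ => q.eval (y : ℂ)) ((derivative q).eval (x : ℂ)) x :=
  (q.hasDerivAt (x : ℂ)).comp_ofReal

theorem continuous_eval_ofReal (q : ℂ[X]) : Continuous fun y : ℝ => q.eval (y : ℂ) :=
  q.continuous.comp Complex.continuous_ofReal

namespace ClassicalWeight

/-- The coefficient of `∂²` in the second-order operator. -/
def aPoly : ClassicalWeight → ℂ[X]
  | hermite _ => 1
  | laguerre _ _ => X
  | jacobi _ _ _ _ => 1 - X ^ 2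

/-- The coefficient of `∂` in the second-order operator. -/
def bPoly : ClassicalWeight → ℂ[X]
  | hermite b => -2 * (X - C (b : ℂ))
  | laguerre a _ => C ((a : ℂ) + 1) - X
  | jacobi a b _ _ => C ((b : ℂ) - a) - X * C ((a : ℂ) + b + 2)

/-- The second-order operator as an endomorphism of `ℂ[x]`. -/
def deltaEnd (w : ClassicalWeight) : PolyEnd := w.delta.1.unop

theorem deltaEnd_apply (w : ClassicalWeight) (p : ℂ[X]) :
    w.deltaEnd p = derivative (derivative p) * w.aPoly + derivative p * w.bPoly := by
  cases w with
  | hermite b =>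
    have : (hermite b).delta = Omega.d * Omega.d
        - (Omega.d * Omega.coef (X - C (b : ℂ)) + Omega.d * Omega.coef (X - C (b : ℂ))) := by
      rw [delta, sq, two_mul]
    rw [deltaEnd, this]
    change derivative (derivative p) - (derivative p * (X - C (b : ℂ))
      + derivative p * (X - C (b : ℂ))) = _
    simp only [aPoly, bPoly]
    ring
  | laguerre a _ =>
    rw [deltaEnd, delta, sq]
    rfl
  | jacobi a b _ _ =>
    rw [deltaEnd, delta, sq]
    rfl

theorem isFiniteOrder_deltaEnd (w : ClassicalWeight) : IsFiniteOrder w.deltaEnd :=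
  isFiniteOrder_unop _

theorem integrable_hermite (b : ℝ) (r : ℂ[X]) :
    Integrable fun x : ℝ => r.eval (x : ℂ) * ((hermite b).weight x : ℂ) := by
  have h1 : ∀ n : ℕ, Integrable fun x : ℝ => x ^ n * Real.exp (-1 * x ^ 2) := fun n => by
    simpa using integrable_rpow_mul_exp_neg_mul_sq (b := 1) one_pos (s := n)
      (by have : (0 : ℝ) ≤ n := n.cast_nonneg
          linarith)
  have h2 := (integrable_eval_mul h1 (r.comp (X + C (b : ℂ)))).comp_sub_right b
  refine (h2.const_mul (Real.exp (b ^ 2) : ℂ)).congr (ae_of_all _ fun x => ?_)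
  -- Completing the square reduces to a translated Gaussian.
  have h3 : (hermite b).weight x = Real.exp (b ^ 2) * Real.exp (-1 * (x - b) ^ 2) := by
    change Real.exp _ = _
    rw [← Real.exp_add]
    congr 1
    ring
  simp only [h3, eval_comp, eval_add, eval_X, eval_C]
  push_cast
  rw [sub_add_cancel]
  ring

theorem integrable_laguerre (a : ℝ) (ha : -1 < a) (r : ℂ[X]) :
    Integrable fun x : ℝ => r.eval (x : ℂ) * ((laguerre a ha).weight x : ℂ) := by
  refine integrable_eval_mul (fun n => ?_) r
  have h0 : (0 : ℝ) ≤ n := n.cast_nonneg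
  have h1 := Real.GammaIntegral_convergent (s := a + n + 1) (by linarith)
  rw [← integrable_indicator_iff measurableSet_Ioi] at h1
  refine h1.congr (ae_of_all _ fun x => ?_)
  by_cases hx : x ∈ Ioi (0 : ℝ)
  · simp only [weight, indicator_of_mem hx]
    rw [add_sub_cancel_right, Real.rpow_add hx, Real.rpow_natCast]
    ring
  · simp only [weight, indicator_of_notMem hx, mul_zero]

/-- Cut at `0`: on each half only one factor can be singular, and the other is continuous on a
compact interval. -/
theorem integrableOn_jacobi (a b : ℝ) (ha : -1 < a) (hb : -1 < b) {f : ℝ → ℂ}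
    (hf : Continuous f) :
    IntegrableOn (fun x : ℝ => f x * (((1 - x) ^ a * (1 + x) ^ b : ℝ) : ℂ)) (Ioo (-1) 1) := by
  have hA : IntegrableOn (fun x : ℝ => (1 - x) ^ a) (Icc 0 1) := by
    rw [← intervalIntegrable_iff_integrableOn_Icc_of_le zero_le_one]
    have := (intervalIntegral.intervalIntegrable_rpow' (a := 0) (b := 1) ha).comp_sub_left 1
    simpa using this.symm
  have hB : IntegrableOn (fun x : ℝ => (1 + x) ^ b) (Icc (-1) 0) := by
    rw [← intervalIntegrable_iff_integrableOn_Icc_of_le (by norm_num)]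
    have := (intervalIntegral.intervalIntegrable_rpow' (a := 0) (b := 1) hb).comp_add_left 1
    simpa using this
  have h1 : IntegrableOn (fun x : ℝ => f x * (((1 - x) ^ a * (1 + x) ^ b : ℝ) : ℂ)) (Icc 0 1) := by
    have hc : ContinuousOn (fun x : ℝ => f x * (((1 + x) ^ b : ℝ) : ℂ)) (Icc 0 1) := by
      refine hf.continuousOn.mul (Complex.continuous_ofReal.comp_continuousOn ?_)
      refine ContinuousOn.rpow_const (by fun_prop) fun x hx => Or.inl ?_
      have := hx.1
      linarith
    refine (IntegrableOn.mul_continuousOn (Integrable.ofReal (𝕜 := ℂ) hA) hc isCompact_Icc).congr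
      (ae_of_all _ fun x => ?_)
    simp
    ring
  have h2 : IntegrableOn (fun x : ℝ => f x * (((1 - x) ^ a * (1 + x) ^ b : ℝ) : ℂ))
      (Icc (-1) 0) := by
    have hc : ContinuousOn (fun x : ℝ => f x * (((1 - x) ^ a : ℝ) : ℂ)) (Icc (-1) 0) := by
      refine hf.continuousOn.mul (Complex.continuous_ofReal.comp_continuousOn ?_)
      refine ContinuousOn.rpow_const (by fun_prop) fun x hx => Or.inl ?_
      have := hx.2
      linarith
    refine (IntegrableOn.mul_continuousOn (Integrable.ofReal (𝕜 := ℂ) hB) hc isCompact_Icc).congr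
      (ae_of_all _ fun x => ?_)
    simp
    ring
  refine (h2.union h1).mono_set fun x hx => ?_
  rcases le_total x 0 with h | h
  · exact Or.inl ⟨hx.1.le, h⟩
  · exact Or.inr ⟨h, hx.2.le⟩

theorem integrable_jacobi (a b : ℝ) (ha : -1 < a) (hb : -1 < b) (r : ℂ[X]) :
    Integrable fun x : ℝ => r.eval (x : ℂ) * ((jacobi a b ha hb).weight x : ℂ) := by
  have h1 := integrableOn_jacobi a b ha hb (continuous_eval_ofReal r)
  rw [← integrable_indicator_iff measurableSet_Ioo] at h1
  refine h1.congr (ae_of_all _ fun x => ?_)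
  by_cases hx : x ∈ Ioo (-1 : ℝ) 1
  · simp only [weight, indicator_of_mem hx]
  · simp only [weight, indicator_of_notMem hx, Complex.ofReal_zero, mul_zero]

theorem integrable (w : ClassicalWeight) (r : ℂ[X]) :
    Integrable fun x : ℝ => r.eval (x : ℂ) * (w.weight x : ℂ) := by
  cases w with
  | hermite b => exact integrable_hermite b r
  | laguerre a ha => exact integrable_laguerre a ha r
  | jacobi a b ha hb => exact integrable_jacobi a b ha hb r

theorem pearson_hermite (b : ℝ) (q : ℂ[X]) :
    ∫ x : ℝ, (derivative q * (hermite b).aPoly + q * (hermite b).bPoly).eval (x : ℂ)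
      * ((hermite b).weight x : ℂ) = 0 := by
  refine integral_eq_zero_of_hasDerivAt_of_integrable
    (f := fun x : ℝ => q.eval (x : ℂ) * ((hermite b).weight x : ℂ)) (fun x => ?_)
    (integrable_hermite b _) (integrable_hermite b q)
  have h1 : HasDerivAt (fun x : ℝ => (hermite b).weight x)
      ((hermite b).weight x * (-(2 * x) + 2 * b)) x := by
    have h2 : HasDerivAt (fun x : ℝ => -x ^ 2 + 2 * b * x) (-(2 * x) + 2 * b) x := by
      exact (((hasDerivAt_pow 2 x).neg).add ((hasDerivAt_id x).const_mul (2 * b))).congr_deriv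
        (by simp)
    exact h2.exp
  refine ((hasDerivAt_eval_ofReal q x).mul h1.ofReal_comp).congr_deriv ?_
  simp [aPoly, bPoly]
  ring

theorem pearson_laguerre (a : ℝ) (ha : -1 < a) (q : ℂ[X]) :
    ∫ x : ℝ, (derivative q * (laguerre a ha).aPoly + q * (laguerre a ha).bPoly).eval (x : ℂ)
      * ((laguerre a ha).weight x : ℂ) = 0 := by
  set f' : ℝ → ℂ := fun x => (derivative q * X + q * (C ((a : ℂ) + 1) - X)).eval (x : ℂ)
    * ((Real.exp (-x) * x ^ a : ℝ) : ℂ) with hf'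
  have h0 : (fun x : ℝ => (derivative q * (laguerre a ha).aPoly
      + q * (laguerre a ha).bPoly).eval (x : ℂ) * ((laguerre a ha).weight x : ℂ))
      = (Ioi (0 : ℝ)).indicator f' := by
    funext x
    by_cases hx : x ∈ Ioi (0 : ℝ)
    · simp only [weight, indicator_of_mem hx, hf', aPoly, bPoly]
    · simp only [weight, indicator_of_notMem hx, Complex.ofReal_zero, mul_zero]
  have hint := integrable_laguerre a ha
    (derivative q * (laguerre a ha).aPoly + q * (laguerre a ha).bPoly)
  rw [h0, integrable_indicator_iff measurableSet_Ioi] at hint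
  rw [h0, integral_indicator measurableSet_Ioi]
  -- The primitive `q · a · w`. Since `a + 1 > 0` it extends continuously by `0` at the origin, and
  -- its integrability gives the limit `0` at infinity.
  set f : ℝ → ℂ := fun x => q.eval (x : ℂ) * ((Real.exp (-x) * x ^ (a + 1) : ℝ) : ℂ) with hf
  have hd : ∀ x ∈ Ioi (0 : ℝ), HasDerivAt f (f' x) x := by
    intro x hx
    have hx0 : x ≠ 0 := (mem_Ioi.1 hx).ne'
    have h1 : HasDerivAt (fun y : ℝ => Real.exp (-y) * y ^ (a + 1))
        (Real.exp (-x) * (-1) * x ^ (a + 1) + Real.exp (-x) * ((a + 1) * x ^ (a + 1 - 1))) x := by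
      exact ((hasDerivAt_neg x).exp).mul (Real.hasDerivAt_rpow_const (Or.inl hx0))
    refine ((hasDerivAt_eval_ofReal q x).mul h1.ofReal_comp).congr_deriv ?_
    simp only [hf', add_sub_cancel_right, Real.rpow_add_one hx0]
    simp
    ring
  have hc : Continuous f := by
    refine (continuous_eval_ofReal q).mul (Complex.continuous_ofReal.comp ?_)
    exact (Real.continuous_exp.comp continuous_neg).mul
      (Real.continuous_rpow_const (by linarith))
  have hfi : IntegrableOn f (Ioi 0) := by
    have := integrable_laguerre (a + 1) (by linarith) q
    have h2 : (fun x : ℝ => q.eval (x : ℂ) * ((laguerre (a + 1) (by linarith)).weight x : ℂ))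
        = (Ioi (0 : ℝ)).indicator f := by
      funext x
      by_cases hx : x ∈ Ioi (0 : ℝ)
      · simp only [weight, indicator_of_mem hx, hf]
      · simp only [weight, indicator_of_notMem hx, Complex.ofReal_zero, mul_zero]
    rwa [h2, integrable_indicator_iff measurableSet_Ioi] at this
  rw [integral_Ioi_of_hasDerivAt_of_tendsto hc.continuousAt.continuousWithinAt hd hint
    (tendsto_zero_of_hasDerivAt_of_integrableOn_Ioi hd hint hfi)]
  simp [hf, Real.zero_rpow (show a + 1 ≠ 0 by linarith)]

theorem pearson_jacobi (a b : ℝ) (ha : -1 < a) (hb : -1 < b) (q : ℂ[X]) :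
    ∫ x : ℝ, (derivative q * (jacobi a b ha hb).aPoly
      + q * (jacobi a b ha hb).bPoly).eval (x : ℂ) * ((jacobi a b ha hb).weight x : ℂ) = 0 := by
  set f' : ℝ → ℂ := fun x => (derivative q * (1 - X ^ 2)
    + q * (C ((b : ℂ) - a) - X * C ((a : ℂ) + b + 2))).eval (x : ℂ)
    * (((1 - x) ^ a * (1 + x) ^ b : ℝ) : ℂ) with hf'
  have h0 : (fun x : ℝ => (derivative q * (jacobi a b ha hb).aPoly
      + q * (jacobi a b ha hb).bPoly).eval (x : ℂ) * ((jacobi a b ha hb).weight x : ℂ))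
      = (Ioo (-1 : ℝ) 1).indicator f' := by
    funext x
    by_cases hx : x ∈ Ioo (-1 : ℝ) 1
    · simp only [weight, indicator_of_mem hx, hf', aPoly, bPoly]
    · simp only [weight, indicator_of_notMem hx, Complex.ofReal_zero, mul_zero]
  have hint := integrableOn_jacobi a b ha hb (continuous_eval_ofReal
    (derivative q * (1 - X ^ 2) + q * (C ((b : ℂ) - a) - X * C ((a : ℂ) + b + 2))))
  rw [h0, integral_indicator measurableSet_Ioo, ← integral_Ioc_eq_integral_Ioo,
    ← intervalIntegral.integral_of_le (by norm_num)]
  -- Again `q · a · w`: the factor `1 - x²` raises both exponents above `0`, so the boundary values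
  -- vanish.
  set f : ℝ → ℂ := fun x => q.eval (x : ℂ)
    * (((1 - x) ^ (a + 1) * (1 + x) ^ (b + 1) : ℝ) : ℂ) with hf
  have hd : ∀ x ∈ Ioo (-1 : ℝ) 1, HasDerivAt f (f' x) x := by
    intro x hx
    have hx1 : 1 - x ≠ 0 := by have := hx.2; intro h; linarith
    have hx2 : 1 + x ≠ 0 := by have := hx.1; intro h; linarith
    have h1 : HasDerivAt (fun y : ℝ => (1 - y) ^ (a + 1))
        (-1 * (a + 1) * (1 - x) ^ (a + 1 - 1)) x :=
      ((hasDerivAt_id x).const_sub 1).rpow_const (Or.inl hx1)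
    have h2 : HasDerivAt (fun y : ℝ => (1 + y) ^ (b + 1)) (1 * (b + 1) * (1 + x) ^ (b + 1 - 1)) x :=
      ((hasDerivAt_id x).const_add 1).rpow_const (Or.inl hx2)
    refine ((hasDerivAt_eval_ofReal q x).mul (h1.mul h2).ofReal_comp).congr_deriv ?_
    simp only [hf', Pi.mul_apply, add_sub_cancel_right, Real.rpow_add_one hx1,
      Real.rpow_add_one hx2]
    simp
    ring
  have hc : Continuous f := by
    refine (continuous_eval_ofReal q).mul (Complex.continuous_ofReal.comp ?_)
    exact ((Real.continuous_rpow_const (by linarith)).comp (continuous_const.sub continuous_id)).mul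
      ((Real.continuous_rpow_const (by linarith)).comp (continuous_const.add continuous_id))
  rw [intervalIntegral.integral_eq_sub_of_hasDerivAt_of_le (by norm_num) hc.continuousOn hd
    ((intervalIntegrable_iff_integrableOn_Ioo_of_le (by norm_num)).2 hint)]
  simp [hf, Real.zero_rpow (show a + 1 ≠ 0 by linarith),
    Real.zero_rpow (show b + 1 ≠ 0 by linarith)]

/-- The Pearson equation `(a w)' = b w`, integrated against polynomials. -/
theorem pearson (w : ClassicalWeight) (q : ℂ[X]) :
    ∫ x : ℝ, (derivative q * w.aPoly + q * w.bPoly).eval (x : ℂ) * (w.weight x : ℂ) = 0 := by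
  cases w with
  | hermite b => exact pearson_hermite b q
  | laguerre a ha => exact pearson_laguerre a ha q
  | jacobi a b ha hb => exact pearson_jacobi a b ha hb q

theorem weight_nonneg (w : ClassicalWeight) (x : ℝ) : 0 ≤ w.weight x := by
  cases w with
  | hermite b => exact (Real.exp_pos _).le
  | laguerre a ha =>
    simp only [weight]
    refine indicator_nonneg (fun y hy => ?_) x
    exact mul_nonneg (Real.exp_pos _).le (Real.rpow_nonneg (mem_Ioi.1 hy).le _)
  | jacobi a b ha hb =>
    simp only [weight]
    refine indicator_nonneg (fun y hy => ?_) x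
    exact mul_nonneg (Real.rpow_nonneg (by linarith [hy.2]) _)
      (Real.rpow_nonneg (by linarith [hy.1]) _)

/-- The interval `(0, 1)` lies in the supports of all three types, and positivity on it suffices for
definiteness of the form. -/
theorem weight_pos (w : ClassicalWeight) {x : ℝ} (hx : x ∈ Ioo (0 : ℝ) 1) : 0 < w.weight x := by
  cases w with
  | hermite b => exact Real.exp_pos _
  | laguerre a ha =>
    have h : x ∈ Ioi (0 : ℝ) := hx.1
    simp only [weight, indicator_of_mem h]
    exact mul_pos (Real.exp_pos _) (Real.rpow_pos_of_pos hx.1 _)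
  | jacobi a b ha hb =>
    have h : x ∈ Ioo (-1 : ℝ) 1 := ⟨by linarith [hx.1], hx.2⟩
    simp only [weight, indicator_of_mem h]
    exact mul_pos (Real.rpow_pos_of_pos (by linarith [hx.2]) _)
      (Real.rpow_pos_of_pos (by linarith [hx.1]) _)

/-! ### The moment form and the symmetry of the second-order operator -/

theorem eval_map_conj (q : ℂ[X]) (x : ℝ) :
    (q.map (starRingEnd ℂ)).eval (x : ℂ) = starRingEnd ℂ (q.eval (x : ℂ)) := by
  have := Polynomial.eval_map_apply (f := starRingEnd ℂ) (p := q) (x : ℂ)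
  rwa [Complex.conj_ofReal] at this

theorem integrable_form (w : ClassicalWeight) (p q : ℂ[X]) :
    Integrable fun x : ℝ => p.eval (x : ℂ) * (w.weight x : ℂ) * starRingEnd ℂ (q.eval (x : ℂ)) := by
  refine (w.integrable (p * q.map (starRingEnd ℂ))).congr (ae_of_all _ fun x => ?_)
  simp only [eval_mul, eval_map_conj]
  ring

/-- The form `∫ p w q̄`. -/
def form (w : ClassicalWeight) : PolyForm :=
  LinearMap.mk₂'ₛₗ (RingHom.id ℂ) (starRingEnd ℂ)
    (fun p q => ∫ x : ℝ, p.eval (x : ℂ) * (w.weight x : ℂ) * starRingEnd ℂ (q.eval (x : ℂ)))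
    (fun p p' q => by
      rw [← integral_add (w.integrable_form _ _) (w.integrable_form _ _)]
      refine integral_congr_ae (ae_of_all _ fun x => ?_)
      simp only [eval_add]
      ring)
    (fun c p q => by
      simp only [eval_smul, smul_eq_mul, mul_assoc, integral_const_mul, RingHom.id_apply])
    (fun p q q' => by
      rw [← integral_add (w.integrable_form _ _) (w.integrable_form _ _)]
      refine integral_congr_ae (ae_of_all _ fun x => ?_)
      simp only [eval_add, map_add]
      ring)
    (fun c p q => by
      simp only [eval_smul, smul_eq_mul, map_mul]
      rw [← integral_const_mul]
      refine integral_congr_ae (ae_of_all _ fun x => ?_)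
      simp only
      ring)

theorem form_apply (w : ClassicalWeight) (p q : ℂ[X]) :
    w.form p q = ∫ x : ℝ, p.eval (x : ℂ) * (w.weight x : ℂ) * starRingEnd ℂ (q.eval (x : ℂ)) := rfl

theorem isPolyInner_form (w : ClassicalWeight) : IsPolyInner w.form where
  conj_symm p q := by
    rw [form_apply, form_apply, ← integral_conj]
    refine integral_congr_ae (ae_of_all _ fun x => ?_)
    simp only [map_mul, Complex.conj_conj, Complex.conj_ofReal]
    ring
  definite p h := by
    by_contra hp
    have h1 : ∀ x : ℝ, p.eval (x : ℂ) * (w.weight x : ℂ) * starRingEnd ℂ (p.eval (x : ℂ))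
        = ((Complex.normSq (p.eval (x : ℂ)) * w.weight x : ℝ) : ℂ) := fun x => by
      push_cast
      rw [Complex.normSq_eq_conj_mul_self]
      ring
    have h2 : Integrable fun x : ℝ => Complex.normSq (p.eval (x : ℂ)) * w.weight x := by
      have := w.integrable_form p p
      simp only [h1] at this
      simpa using this.re
    rw [form_apply] at h
    simp only [h1] at h
    rw [integral_complex_ofReal, Complex.ofReal_eq_zero, integral_eq_zero_iff_of_nonneg
      (fun x => mul_nonneg (Complex.normSq_nonneg _) (w.weight_nonneg x)) h2] at h
    have hfin : ({x : ℝ | p.eval (x : ℂ) = 0}).Finite := by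
      refine Set.Finite.preimage (f := fun x : ℝ => (x : ℂ)) (s := {z | p.IsRoot z})
        (Complex.ofReal_injective.injOn) (Polynomial.finite_setOfPred_isRoot hp)
    have h3 : ∀ᵐ x : ℝ, x ∉ Ioo (0 : ℝ) 1 := by
      filter_upwards [h, hfin.countable.ae_notMem volume] with x hx hx' hmem
      have := mul_ne_zero (Complex.normSq_eq_zero.not.2 hx') (w.weight_pos hmem).ne'
      exact this hx
    rw [ae_iff] at h3
    simp only [not_not, ofPred_mem_eq, Real.volume_Ioo] at h3
    norm_num at h3
  mul_X p q := by
    rw [form_apply, form_apply]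
    refine integral_congr_ae (ae_of_all _ fun x => ?_)
    simp only [eval_mul, eval_X, map_mul, Complex.conj_ofReal]
    ring

theorem map_conj_aPoly (w : ClassicalWeight) : w.aPoly.map (starRingEnd ℂ) = w.aPoly := by
  cases w <;> simp [aPoly]

/-- Integration by parts: the Pearson equation for `p' q̄` has integrand `(δ p) q̄ w + a p' q̄' w`.
-/
theorem form_deltaEnd_left (w : ClassicalWeight) (p q : ℂ[X]) :
    w.form (w.deltaEnd p) q = -∫ x : ℝ, (w.aPoly * derivative p
      * derivative (q.map (starRingEnd ℂ))).eval (x : ℂ) * (w.weight x : ℂ) := by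
  rw [eq_neg_iff_add_eq_zero, form_apply,
    ← integral_add (w.integrable_form _ _) (w.integrable _),
    ← w.pearson (derivative p * q.map (starRingEnd ℂ))]
  refine integral_congr_ae (ae_of_all _ fun x => ?_)
  simp only [deltaEnd_apply, ← eval_map_conj, derivative_mul, eval_add, eval_mul]
  ring

/-- The integral of `a p' q̄' w` is Hermitian in `p` and `q`, because `a` and `w` are real. -/
theorem deltaEnd_symmetric (w : ClassicalWeight) (p q : ℂ[X]) :
    w.form (w.deltaEnd p) q = w.form p (w.deltaEnd q) := by
  have hpp : ∀ (r : ℂ[X]) (x : ℝ), starRingEnd ℂ ((r.map (starRingEnd ℂ)).eval (x : ℂ))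
      = r.eval (x : ℂ) := fun r x => by rw [eval_map_conj, Complex.conj_conj]
  have ha : ∀ x : ℝ, starRingEnd ℂ (w.aPoly.eval (x : ℂ)) = w.aPoly.eval (x : ℂ) := fun x => by
    rw [← eval_map_conj, map_conj_aPoly]
  have hint : ∫ x : ℝ, (w.aPoly * derivative p
      * derivative (q.map (starRingEnd ℂ))).eval (x : ℂ) * (w.weight x : ℂ)
      = starRingEnd ℂ (∫ x : ℝ, (w.aPoly * derivative q
      * derivative (p.map (starRingEnd ℂ))).eval (x : ℂ) * (w.weight x : ℂ)) := by
    rw [← integral_conj]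
    refine integral_congr_ae (ae_of_all _ fun x => ?_)
    simp only [derivative_map, eval_mul, map_mul, Complex.conj_ofReal, ha, hpp]
    rw [eval_map_conj]
    ring
  rw [← w.isPolyInner_form.conj_symm (w.deltaEnd q) p, form_deltaEnd_left, form_deltaEnd_left,
    map_neg, hint]

end ClassicalWeight

end Moments

/-! ### Principal symbols of commutators -/

theorem C_two : (C 2 : ℂ[X]) = 2 := map_ofNat C 2

theorem commutator_mulEnd {U : PolyEnd} {f : ℂ[X]} (hU : theta U = mulEnd f) (a : ℂ[X]) :
    U * mulEnd a - mulEnd a * U = mulEnd (derivative a * f) := by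
  -- `U` is first-order with leading term `f ∂`, so `U p = f p' + g p` for a fixed `g`.
  have h0 : theta (U - mulEnd f * derivative) = 0 := by
    rw [map_sub, hU, theta_mul, theta_mulEnd, theta_derivative, zero_mul, zero_add, mul_one,
      sub_self]
  have h1 : ∀ p, U p = derivative p * f + p * (U 1 - derivative 1 * f) := fun p => by
    have := congrArg (fun T : PolyEnd => T p) (eq_mulEnd_of_theta_eq_zero h0)
    simp only [LinearMap.sub_apply, Module.End.mul_apply, LinearMap.mulRight_apply] at this ⊢
    linear_combination this
  generalize U 1 - derivative 1 * f = g at h1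
  refine LinearMap.ext fun p => ?_
  simp only [LinearMap.sub_apply, Module.End.mul_apply, LinearMap.mulRight_apply, h1,
    derivative_mul]
  ring

theorem theta_pow_commutator_mulEnd (U : PolyEnd) (a : ℂ[X]) (k : ℕ) :
    (theta ^ k) (U * mulEnd a - mulEnd a * U)
      = (theta ^ k) U * mulEnd a - mulEnd a * (theta ^ k) U := by
  induction k generalizing U with
  | zero => rfl
  | succ k ih =>
    rw [theta_pow_succ, map_sub, theta_mul, theta_mul, theta_mulEnd, mul_zero, zero_mul, add_zero,
      zero_add, ih, ← theta_pow_succ]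

/-- The first-order operator `p ↦ 2 a p' + b p`. -/
def firstOrder (a b : ℂ[X]) : PolyEnd := mulEnd (2 * a) * derivative + mulEnd b

theorem theta_firstOrder (a b : ℂ[X]) : theta (firstOrder a b) = mulEnd (2 * a) := by
  rw [firstOrder, map_add, theta_mul, theta_mulEnd, theta_mulEnd, theta_derivative]
  simp

/-- Each application of `theta` replaces `V` by `theta V` and adds the commutator of `V` with
multiplication by `2a`, whose symbol is `2a' f`; this accumulates to the term with `2k`. -/
theorem theta_pow_commutator_firstOrder {V : PolyEnd} {f : ℂ[X]} {k : ℕ}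
    (hV : (theta ^ k) V = mulEnd f) (a b b' : ℂ[X]) :
    (theta ^ k) (V * firstOrder a b - firstOrder a b' * V)
      = mulEnd (-2 * a * derivative f + (b - b') * f + C (2 * (k : ℂ)) * derivative a * f) := by
  induction k generalizing V with
  | zero =>
    obtain rfl : V = mulEnd f := by simpa using hV
    refine LinearMap.ext fun p => ?_
    simp [firstOrder]
    ring
  | succ k ih =>
    have h1 : theta (V * firstOrder a b - firstOrder a b' * V)
        = (theta V * firstOrder a b - firstOrder a b' * theta V)
          + (V * mulEnd (2 * a) - mulEnd (2 * a) * V) := by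
      rw [map_sub, theta_mul, theta_mul, theta_firstOrder, theta_firstOrder]
      abel
    rw [theta_pow_succ, h1, map_add, ih (by rwa [← theta_pow_succ]), theta_pow_commutator_mulEnd,
      commutator_mulEnd (f := f) (by rw [← theta_pow_succ', hV])]
    refine LinearMap.ext fun p => ?_
    simp [C_two]
    ring

/-- The second-order operator `p ↦ a p'' + b p'`. -/
def secondOrder (a b : ℂ[X]) : PolyEnd :=
  mulEnd a * (derivative * derivative) + mulEnd b * derivative

theorem theta_secondOrder (a b : ℂ[X]) : theta (secondOrder a b) = firstOrder a b := by
  rw [secondOrder, firstOrder, map_add, theta_mul, theta_mul, theta_mul, theta_mulEnd, theta_mulEnd,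
    theta_derivative]
  refine LinearMap.ext fun p => ?_
  simp only [LinearMap.add_apply, Module.End.mul_apply, LinearMap.mulRight_apply,
    zero_mul, zero_add, one_mul, mul_one]
  ring

theorem theta_pow_commutator_secondOrder {V : PolyEnd} {f : ℂ[X]} {k : ℕ}
    (hV : (theta ^ k) V = mulEnd f) (a b b' : ℂ[X]) :
    (theta ^ (k + 1)) (V * secondOrder a b - secondOrder a b' * V)
      = mulEnd (C ((k : ℂ) + 1) *
        (-2 * a * derivative f + (b - b') * f + C (k : ℂ) * derivative a * f)) := by
  induction k generalizing V with
  | zero =>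
    obtain rfl : V = mulEnd f := by simpa using hV
    have h1 : theta (mulEnd f * secondOrder a b - secondOrder a b' * mulEnd f)
        = mulEnd f * firstOrder a b - firstOrder a b' * mulEnd f := by
      rw [map_sub, theta_mul, theta_mul, theta_mulEnd, theta_secondOrder, theta_secondOrder]
      simp
    rw [zero_add, pow_one, h1]
    refine LinearMap.ext fun p => ?_
    simp [firstOrder]
    ring
  | succ k ih =>
    have h1 : theta (V * secondOrder a b - secondOrder a b' * V)
        = (theta V * secondOrder a b - secondOrder a b' * theta V)
          + (V * firstOrder a b - firstOrder a b' * V) := by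
      rw [map_sub, theta_mul, theta_mul, theta_secondOrder, theta_secondOrder]
      abel
    rw [theta_pow_succ, h1, map_add, ih (by rwa [← theta_pow_succ]),
      theta_pow_commutator_firstOrder hV]
    refine LinearMap.ext fun p => ?_
    simp [C_two]
    ring

/-- The coefficient of order `k + 1` in the vanishing difference. The order `k + 2` cancels since
both operators share `a`, and what is left is a first-order equation for the symbol of `V`. -/
theorem symbol_equation {V : PolyEnd} {f a b b' : ℂ[X]} {k : ℕ}
    (hV : (theta ^ k) V = mulEnd f) (h : V * secondOrder a b = secondOrder a b' * V) :
    2 * a * derivative f = (C (k : ℂ) * derivative a + (b - b')) * f := by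
  have h1 := theta_pow_commutator_secondOrder hV a b b'
  rw [h, sub_self, map_zero, ← mulEnd_zero] at h1
  have h2 := (mul_eq_zero.1 (mulEnd_injective h1).symm).resolve_left 
    (C_ne_zero.2 (by exact_mod_cast k.succ_ne_zero))
  linear_combination -h2

/-! ### Polynomial solutions of the symbol equation -/

/-- The indicial equation at a zero `r` of `a`, and the regularity of solutions elsewhere. -/
theorem indicial_identity {f a h : ℂ[X]} (hf : f ≠ 0) (hode : 2 * a * derivative f = h * f)
    (r : ℂ) : ∃ g : ℂ[X], g.eval r ≠ 0 ∧ f = (X - C r) ^ f.rootMultiplicity r * g ∧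
      2 * a * (C (f.rootMultiplicity r : ℂ) * g + (X - C r) * derivative g)
        = (X - C r) * h * g := by
  obtain ⟨g, hg, hgr⟩ := exists_eq_pow_rootMultiplicity_mul_and_not_dvd f hf r
  refine ⟨g, by rwa [dvd_iff_isRoot] at hgr, hg, ?_⟩
  set m := f.rootMultiplicity r
  have hX : (X - C r) ^ m ≠ 0 := pow_ne_zero _ (X_sub_C_ne_zero r)
  apply mul_left_cancel₀ hX
  have h1 : (X - C r) * derivative f
      = (X - C r) ^ m * (C (m : ℂ) * g + (X - C r) * derivative g) := by
    rw [hg, derivative_mul, derivative_X_sub_C_pow]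
    rcases Nat.eq_zero_or_pos m with h0 | h0
    · simp [h0]
    · obtain ⟨j, hj⟩ := Nat.exists_eq_succ_of_ne_zero h0.ne'
      rw [hj, Nat.succ_eq_add_one, Nat.add_sub_cancel]
      push_cast
      simp
      ring
  calc _ = 2 * a * ((X - C r) * derivative f) := by rw [h1]; ring
    _ = (X - C r) * (2 * a * derivative f) := by ring
    _ = (X - C r) * (h * f) := by rw [hode]
    _ = (X - C r) * (h * ((X - C r) ^ m * g)) := by rw [← hg]
    _ = _ := by ring

theorem indicial_equation {f a h : ℂ[X]} (hf : f ≠ 0) (hode : 2 * a * derivative f = h * f)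
    {r : ℂ} (har : a.eval r = 0) :
    2 * (derivative a).eval r * f.rootMultiplicity r = h.eval r := by
  obtain ⟨g, hg, -, h1⟩ := indicial_identity hf hode r
  -- Both sides vanish at `r`, so the information sits in the first derivative there.
  have h2 := congrArg (fun p => (derivative p).eval r) h1
  simp [har] at h2
  exact mul_right_cancel₀ hg (by linear_combination h2)

theorem eval_ne_zero_of_ode {f a h : ℂ[X]} (hf : f ≠ 0) (hode : 2 * a * derivative f = h * f)
    {r : ℂ} (har : a.eval r ≠ 0) : f.eval r ≠ 0 := by
  obtain ⟨g, hg, -, h1⟩ := indicial_identity hf hode r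
  have h2 := congrArg (fun p => p.eval r) h1
  simp [har, hg] at h2
  exact fun h0 => hf (h2 h0)

namespace ClassicalWeight

/-! ### Orthogonal polynomials of the classical weights -/

/-- The monic orthogonal polynomials of a classical weight. -/
def poly (w : ClassicalWeight) : ℕ → ℂ[X] := w.isPolyInner_form.exists_isOPS.choose

theorem isOPS_poly (w : ClassicalWeight) : IsOPS w.form w.poly :=
  w.isPolyInner_form.exists_isOPS.choose_spec

/-- The eigenvalues of the second-order operator. -/
def eig : ClassicalWeight → ℕ → ℂ
  | hermite _ => fun n => -2 * n
  | laguerre _ _ => fun n => -n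
  | jacobi a b _ _ => fun n => -(n * (n + (a + b + 1)))

theorem deltaEnd_eq_secondOrder (w : ClassicalWeight) :
    w.deltaEnd = secondOrder w.aPoly w.bPoly := by
  refine LinearMap.ext fun p => ?_
  rw [deltaEnd_apply]
  rfl

theorem coeff_derivative_mul_X (p : ℂ[X]) (m : ℕ) :
    (derivative p * X).coeff m = m * p.coeff m := by
  cases m with
  | zero => simp
  | succ m => rw [coeff_mul_X, coeff_derivative]; push_cast; ring

/-- Only triangularity and the diagonal entry `eig m` matter; `u` and `v` multiply higher
coefficients, absent at the top degree. -/
theorem coeff_deltaEnd (w : ClassicalWeight) (p : ℂ[X]) (m : ℕ) :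
    ∃ u v : ℂ, (w.deltaEnd p).coeff m
      = w.eig m * p.coeff m + u * p.coeff (m + 1) + v * p.coeff (m + 2) := by
  have hX2 : (derivative (derivative p) * X ^ 2).coeff m = m * (m - 1) * p.coeff m := by
    rcases m with _ | _ | m
    · simp
    · simp [pow_two, ← mul_assoc]
    · rw [coeff_mul_X_pow, coeff_derivative, coeff_derivative]
      push_cast
      ring
  rw [deltaEnd_apply]
  cases w with
  | hermite b =>
    refine ⟨2 * b * (m + 1), (m + 2) * (m + 1), ?_⟩
    have : derivative (derivative p) * (hermite b).aPoly + derivative p * (hermite b).bPoly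
        = derivative (derivative p) + C (-2) * (derivative p * X)
          + C (2 * (b : ℂ)) * derivative p := by
      simp only [aPoly, bPoly]
      simp [C_two]
      ring
    rw [this, coeff_add, coeff_add, coeff_C_mul, coeff_C_mul, coeff_derivative_mul_X]
    simp only [coeff_derivative, eig]
    push_cast
    ring
  | laguerre a ha =>
    refine ⟨(m + 1) * m + (a + 1) * (m + 1), 0, ?_⟩
    have : derivative (derivative p) * (laguerre a ha).aPoly
          + derivative p * (laguerre a ha).bPoly
        = derivative (derivative p) * X - derivative p * X + C ((a : ℂ) + 1) * derivative p := by
      simp only [aPoly, bPoly]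
      ring
    rw [this, coeff_add, coeff_sub, coeff_C_mul, coeff_derivative_mul_X, coeff_derivative_mul_X]
    simp only [coeff_derivative, eig]
    ring
  | jacobi a b ha hb =>
    refine ⟨(b - a) * (m + 1), (m + 2) * (m + 1), ?_⟩
    have : derivative (derivative p) * (jacobi a b ha hb).aPoly
          + derivative p * (jacobi a b ha hb).bPoly
        = derivative (derivative p) - derivative (derivative p) * X ^ 2
          + C ((b : ℂ) - a) * derivative p - C ((a : ℂ) + b + 2) * (derivative p * X) := by
      simp only [aPoly, bPoly]
      ring
    rw [this, coeff_sub, coeff_add, coeff_sub, coeff_C_mul, coeff_C_mul, coeff_derivative_mul_X,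
      hX2]
    simp only [coeff_derivative, eig]
    push_cast
    ring

theorem deltaEnd_poly (w : ClassicalWeight) (n : ℕ) :
    w.deltaEnd (w.poly n) = w.eig n • w.poly n := by
  have h := w.isOPS_poly.eigen_of_symmetric w.isPolyInner_form w.deltaEnd_symmetric
    (fun n p hp => by
      rw [degree_lt_iff_coeff_zero] at hp ⊢
      intro m hm
      obtain ⟨u, v, huv⟩ := w.coeff_deltaEnd p m
      rw [huv, hp m hm, hp (m + 1) (by omega), hp (m + 2) (by omega)]
      simp) n
  obtain ⟨u, v, huv⟩ := w.coeff_deltaEnd (w.poly n) n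
  have h0 : ∀ m, n < m → (w.poly n).coeff m = 0 := fun m hm =>
    coeff_eq_zero_of_natDegree_lt (by rwa [w.isOPS_poly.natDegree_eq])
  rw [h0 (n + 1) (by omega), h0 (n + 2) (by omega), w.isOPS_poly.coeff_self] at huv
  rw [h, huv]
  simp

theorem eig_injective (w : ClassicalWeight) : Function.Injective w.eig := by
  intro m n h
  cases w with
  | hermite b => simpa [eig] using h
  | laguerre a ha => simpa [eig] using h
  | jacobi a b ha hb =>
    have h1 : (m : ℝ) * (m + (a + b + 1)) = n * (n + (a + b + 1)) := by
      have := neg_injective h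
      exact_mod_cast this
    by_contra hne
    have h2 : ((m : ℝ) - n) * (m + n + (a + b + 1)) = 0 := by linear_combination h1
    have h3 : (m : ℝ) - n ≠ 0 := sub_ne_zero.2 (by exact_mod_cast hne)
    -- Distinct indices have sum at least `1`, and `a + b + 1 > -1`, so the second factor is
    -- positive.
    have h4 : (1 : ℝ) ≤ m + n := by
      have : 1 ≤ m + n := by omega
      exact_mod_cast this
    rcases mul_eq_zero.1 h2 with h5 | h5
    · exact h3 h5
    · linarith

/-- Operators of finite order that map the orthogonal polynomials of `v` to multiples of those
of `w`. -/
def IsHom (v w : ClassicalWeight) (T : PolyEnd) : Prop :=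
  IsFiniteOrder T ∧ ∃ c : ℕ → ℂ, ∀ n, T (v.poly n) = c n • w.poly n

theorem IsHom.add {v w : ClassicalWeight} {S T : PolyEnd} (hS : IsHom v w S) (hT : IsHom v w T) :
    IsHom v w (S + T) := by
  obtain ⟨hS, c, hc⟩ := hS
  obtain ⟨hT, d, hd⟩ := hT
  exact ⟨hS.add hT, fun n => c n + d n, fun n => by
    rw [LinearMap.add_apply, hc, hd, add_smul]⟩

theorem IsHom.smul {v w : ClassicalWeight} {S : PolyEnd} (hS : IsHom v w S) (z : ℂ) :
    IsHom v w (z • S) := by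
  obtain ⟨hS, c, hc⟩ := hS
  exact ⟨hS.smul z, fun n => z * c n, fun n => by rw [LinearMap.smul_apply, hc, smul_smul]⟩

theorem IsHom.mul {u v w : ClassicalWeight} {S T : PolyEnd} (hS : IsHom v w S)
    (hT : IsHom u v T) : IsHom u w (S * T) := by
  obtain ⟨hS, c, hc⟩ := hS
  obtain ⟨hT, d, hd⟩ := hT
  exact ⟨hS.mul hT, fun n => d n * c n, fun n => by
    rw [Module.End.mul_apply, hd, map_smul, hc, smul_smul]⟩

theorem aeval_deltaEnd_poly (w : ClassicalWeight) (q : ℂ[X]) (n : ℕ) :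
    aeval w.deltaEnd q (w.poly n) = q.eval (w.eig n) • w.poly n := by
  induction q using Polynomial.induction_on' with
  | add p q hp hq => rw [map_add, LinearMap.add_apply, hp, hq, eval_add, add_smul]
  | monomial k c =>
    have : ∀ k : ℕ, (w.deltaEnd ^ k) (w.poly n) = w.eig n ^ k • w.poly n := by
      intro k
      induction k with
      | zero => simp
      | succ k ih =>
        rw [pow_succ', Module.End.mul_apply, ih, map_smul, deltaEnd_poly, smul_smul, pow_succ]
    rw [aeval_monomial, ← Algebra.smul_def, LinearMap.smul_apply, this, eval_monomial, smul_smul]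

theorem isHom_aeval (w : ClassicalWeight) (q : ℂ[X]) : IsHom w w (aeval w.deltaEnd q) :=
  ⟨w.isFiniteOrder_deltaEnd.aeval q, _, w.aeval_deltaEnd_poly q⟩

theorem IsHom.comm {v w : ClassicalWeight} {V : PolyEnd} (hV : IsHom v w V)
    (he : v.eig = w.eig) (q : ℂ[X]) :
    V * aeval v.deltaEnd q = aeval w.deltaEnd q * V := by
  obtain ⟨-, c, hc⟩ := hV
  refine v.isOPS_poly.end_ext fun n => ?_
  simp only [Module.End.mul_apply, hc, aeval_deltaEnd_poly, map_smul, he, smul_smul]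
  rw [mul_comm]

theorem IsHom.comm_delta {v w : ClassicalWeight} {V : PolyEnd} (hV : IsHom v w V)
    (he : v.eig = w.eig) : V * v.deltaEnd = w.deltaEnd * V := by
  simpa using hV.comm he X

/-- `V (v.poly n)` is an eigenvector of the second-order operator of `w`, whose eigenvalues are
simple. -/
theorem isHom_of_comm {v w : ClassicalWeight} {V : PolyEnd} (hV : IsFiniteOrder V)
    (he : v.eig = w.eig) (h : V * v.deltaEnd = w.deltaEnd * V) : IsHom v w V := by
  have : ∀ n, ∃ c : ℂ, V (v.poly n) = c • w.poly n := fun n => by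
    refine w.isOPS_poly.eq_smul_of_eigen w.deltaEnd_poly w.eig_injective ?_
    rw [← Module.End.mul_apply, ← h, Module.End.mul_apply, deltaEnd_poly, map_smul, he]
  choose c hc using this
  exact ⟨hV, c, hc⟩

theorem IsHom.degree_lt {v w : ClassicalWeight} {V : PolyEnd} (hV : IsHom v w V) {n : ℕ}
    {p : ℂ[X]} (hp : p.degree < n) : (V p).degree < n := by
  obtain ⟨-, c, hc⟩ := hV
  refine degree_lt_induction (P := v.poly) (n := n) (C := fun p => (V p).degree < n)
    (fun m _ => v.isOPS_poly.monic m) (fun m _ => v.isOPS_poly.natDegree_eq m)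
    (by simp) ?_ p hp
  intro m hm z r hr
  rw [map_add, map_smul, hc]
  refine (degree_add_le _ _).trans_lt (max_lt hr ?_)
  refine (degree_smul_le _ _).trans_lt ((degree_smul_le _ _).trans_lt ?_)
  rw [degree_eq_natDegree (w.isOPS_poly.ne_zero m), w.isOPS_poly.natDegree_eq]
  exact_mod_cast hm

/-- The eigenvalues of an operator in `IsHom v w` are polynomial in `n`. -/
theorem IsHom.exists_polynomial {v w : ClassicalWeight} {V : PolyEnd} (hV : IsHom v w V) :
    ∃ q : ℂ[X], ∀ n : ℕ, V (v.poly n) = q.eval (n : ℂ) • w.poly n := by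
  obtain ⟨q, hq⟩ := IsDiffOp.exists_eigenvalue_polynomial ((isDiffOp_op_iff V).2 hV.1)
  refine ⟨q, fun n => ?_⟩
  obtain ⟨-, c, hc⟩ := id hV
  -- `V` does not raise degrees, so the coefficient of `x ^ n` is the same for the images of `x ^ n`
  -- and of the monic `v.poly n`.
  have h1 : (X ^ n - v.poly n).degree < (n : WithBot ℕ) := by
    have := natDegree_sub_smul_lt (p := X ^ n) (v.isOPS_poly.monic n)
      (v.isOPS_poly.natDegree_eq n) (natDegree_X_pow_le n)
    simpa using this
  have h2 := coeff_eq_zero_of_degree_lt (hV.degree_lt h1)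
  have h3 := hq n
  rw [MulOpposite.unop_op] at h3
  rw [map_sub, coeff_sub, h3, hc, coeff_smul, w.isOPS_poly.coeff_self, smul_eq_mul, mul_one,
    sub_eq_zero] at h2
  rw [hc, h2]

/-! ### Endomorphisms of a single weight -/

theorem exists_theta_pow_deltaEnd_pow (w : ClassicalWeight) (m : ℕ) :
    (theta ^ (2 * m + 1)) (w.deltaEnd ^ m) = 0 ∧
      ∃ z : ℂ, z ≠ 0 ∧ (theta ^ (2 * m)) (w.deltaEnd ^ m) = mulEnd (C z * w.aPoly ^ m) := by
  have hd2 : (theta ^ 2) w.deltaEnd = mulEnd (2 * w.aPoly) := by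
    rw [theta_pow_succ, pow_one, deltaEnd_eq_secondOrder, theta_secondOrder, theta_firstOrder]
  have hd3 : (theta ^ (2 + 1)) w.deltaEnd = 0 := by
    rw [theta_pow_succ', hd2, theta_mulEnd]
  induction m with
  | zero =>
    refine ⟨by simp [theta_apply], 1, one_ne_zero, ?_⟩
    refine LinearMap.ext fun p => ?_
    simp
  | succ m ih =>
    obtain ⟨h1, z, hz, h2⟩ := ih
    rw [pow_succ w.deltaEnd, show 2 * (m + 1) = 2 * m + 2 by ring]
    refine ⟨theta_pow_mul_eq_zero h1 hd3, (2 * m + 2).choose (2 * m) * z * 2, ?_, ?_⟩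
    · have : (2 * m + 2).choose (2 * m) ≠ 0 := (Nat.choose_pos (by omega)).ne'
      exact mul_ne_zero (mul_ne_zero (by exact_mod_cast this) hz) two_ne_zero
    · rw [theta_pow_mul_top h1 hd3, h2, hd2]
      refine LinearMap.ext fun p => ?_
      simp [C_two]
      ring

/-- Induction on the order. The indicial equation at `1` makes the order `2m`, with `m` the
multiplicity of the symbol there. Subtracting a multiple of `δ ^ m` makes the symbol vanish at `0`;
as `0` is not a zero of `1 - x²`, `eval_ne_zero_of_ode` then forces the symbol to be zero. -/
theorem exists_aeval_of_isHom_jacobi {a b : ℝ} {ha : -1 < a} {hb : -1 < b} {V : PolyEnd}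
    (hV : IsHom (jacobi a b ha hb) (jacobi a b ha hb) V) :
    ∃ q : ℂ[X], V = aeval (jacobi a b ha hb).deltaEnd q := by
  set w := jacobi a b ha hb with hw
  have hode : ∀ {V : PolyEnd} {f : ℂ[X]} {k : ℕ}, IsHom w w V → (theta ^ k) V = mulEnd f →
      2 * w.aPoly * derivative f = (C (k : ℂ) * derivative w.aPoly) * f := by
    intro V f k hV hf
    have h1 := hV.comm_delta rfl
    rw [deltaEnd_eq_secondOrder] at h1
    simpa using symbol_equation hf h1
  obtain ⟨k, hk⟩ := hV.1
  induction k using Nat.strong_induction_on generalizing V with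
  | _ k ih =>
    rcases k with _ | k
    · exact ⟨0, by simpa using hk⟩
    obtain ⟨f, hf⟩ := exists_mulEnd_of_theta_pow hk
    by_cases hf0 : f = 0
    · exact ih k (by omega) hV (by rw [hf, hf0, mulEnd_zero])
    have h1 := indicial_equation hf0 (hode hV hf) (r := 1) (by simp [hw, aPoly])
    set m := f.rootMultiplicity 1
    obtain rfl : k = 2 * m := by
      have h2 : (derivative w.aPoly).eval 1 = -2 := by simp [hw, aPoly]; norm_num
      rw [eval_mul, eval_C, h2] at h1
      have h3 : (k : ℂ) = 2 * m := by linear_combination h1 / 2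
      exact_mod_cast h3
    obtain ⟨-, z, hz, hm⟩ := w.exists_theta_pow_deltaEnd_pow m
    have hpow : IsHom w w (w.deltaEnd ^ m) := by simpa using w.isHom_aeval (X ^ m)
    set V' := V + (-(f.eval 0 / z)) • w.deltaEnd ^ m with hV'
    have hV'hom : IsHom w w V' := hV.add (hpow.smul _)
    have hsym : (theta ^ (2 * m)) V' = mulEnd (f - C (f.eval 0) * w.aPoly ^ m) := by
      rw [hV', map_add, map_smul, hf, hm]
      refine LinearMap.ext fun p => ?_
      have hzz : C (-(f.eval 0 / z)) * C z = -C (f.eval 0) := by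
        rw [← C_mul, ← C_neg]
        congr 1
        field_simp
      simp only [LinearMap.add_apply, LinearMap.smul_apply, LinearMap.mulRight_apply,
        smul_eq_C_mul]
      linear_combination (p * w.aPoly ^ m) * hzz
    have hzero : f - C (f.eval 0) * w.aPoly ^ m = 0 := by
      by_contra hne
      refine eval_ne_zero_of_ode hne (hode hV'hom hsym) (r := 0) ?_ ?_
      · simp [hw, aPoly]
      · simp [hw, aPoly]
    obtain ⟨q, hq⟩ := ih (2 * m) (by omega) hV'hom (by rw [hsym, hzero, mulEnd_zero])
    refine ⟨q + C (f.eval 0 / z) * X ^ m, ?_⟩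
    rw [map_add, ← hq, hV', map_mul, aeval_C, map_pow, aeval_X, ← Algebra.smul_def,
      add_assoc, ← add_smul, neg_add_cancel, zero_smul, add_zero]

/-- The eigenvalues of `V` are polynomial in `n`, and `n` is the eigenvalue of δ divided by `z`. -/
theorem exists_aeval_of_eig_linear {w : ClassicalWeight} {z : ℂ} (hz : z ≠ 0)
    (he : ∀ n : ℕ, w.eig n = z * n) {V : PolyEnd} (hV : IsHom w w V) :
    ∃ q : ℂ[X], V = aeval w.deltaEnd q := by
  obtain ⟨q, hq⟩ := hV.exists_polynomial
  refine ⟨q.comp (C z⁻¹ * X), w.isOPS_poly.end_ext fun n => ?_⟩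
  rw [hq, aeval_deltaEnd_poly, he, eval_comp]
  simp [hz]

/-- The operators that have the orthogonal polynomials of a classical weight as eigenfunctions
are the polynomials in its second-order operator. -/
theorem IsHom.exists_aeval {w : ClassicalWeight} {V : PolyEnd} (hV : IsHom w w V) :
    ∃ q : ℂ[X], V = aeval w.deltaEnd q := by
  cases w with
  | hermite b => exact exists_aeval_of_eig_linear (z := -2) (by norm_num) (fun _ => rfl) hV
  | laguerre a ha =>
    exact exists_aeval_of_eig_linear (z := -1) (by norm_num) (fun n => by simp [eig]) hV
  | jacobi a b ha hb => exact exists_aeval_of_isHom_jacobi hV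

end ClassicalWeight

/-! ### Equality of eigenvalues for weights joined by a morphism -/

/-- A polynomial invariant under two different reflections is constant. -/
theorem eq_C_of_two_reflections {r : ℂ[X]} {s t : ℂ} (hst : s ≠ t)
    (hs : ∀ x, r.eval (-s - x) = r.eval x) (ht : ∀ x, r.eval (-t - x) = r.eval x) :
    r = C (r.eval 0) := by
  -- The two reflections compose to a translation by `t - s`.
  have hper : ∀ n : ℕ, r.eval (n * (t - s)) = r.eval 0 := by
    intro n
    induction n with
    | zero => simp
    | succ n ih =>
      rw [← ih, ← ht (n * (t - s)), ← hs (-t - n * (t - s))]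
      congr 1
      push_cast
      ring
  refine eq_of_infinite_eval_eq _ _ ((Set.infinite_range_of_injective
    (f := fun n : ℕ => (n : ℂ) * (t - s)) fun m n h => ?_).mono ?_)
  · exact_mod_cast mul_right_cancel₀ (sub_ne_zero.2 hst.symm) h
  · rintro _ ⟨n, rfl⟩
    simp [hper]

namespace ClassicalWeight

theorem poly_zero (w : ClassicalWeight) : w.poly 0 = 1 :=
  (Monic.natDegree_eq_zero (w.isOPS_poly.monic 0)).1 (w.isOPS_poly.natDegree_eq 0)

/-- The orthogonal polynomials of degree at most two cannot satisfy `P₂' P₁ = 2 P₂`. -/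
theorem derivative_poly_two_mul_poly_one_ne (w : ClassicalWeight) :
    derivative (w.poly 2) * w.poly 1 ≠ 2 * w.poly 2 := by
  intro h
  have hd1 : derivative (w.poly 1) = 1 := by
    have h1 := (w.isOPS_poly.monic 1).eq_X_add_C (w.isOPS_poly.natDegree_eq 1)
    rw [h1]
    simp
  have hd2 : derivative (derivative (w.poly 2)) = 2 := by
    have h1 : (derivative (derivative (w.poly 2))).natDegree = 0 := by
      have h2 := natDegree_derivative_le (derivative (w.poly 2))
      have h3 := natDegree_derivative_le (w.poly 2)
      rw [w.isOPS_poly.natDegree_eq] at h3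
      omega
    rw [eq_C_of_natDegree_eq_zero h1, coeff_derivative, coeff_derivative, w.isOPS_poly.coeff_self]
    simp
    norm_num
  have h2 := congrArg derivative h
  rw [derivative_mul, hd1, hd2] at h2
  simp only [derivative_mul, derivative_ofNat] at h2
  -- Differentiating the relation gives `P₂' = 2 P₁`, and substituting back gives `P₂ = P₁²`.
  have h3 : w.poly 2 = w.poly 1 * w.poly 1 := by
    have h4 : derivative (w.poly 2) = 2 * w.poly 1 := by linear_combination -h2
    rw [h4] at h
    exact mul_left_cancel₀ (two_ne_zero (α := ℂ[X])) (by linear_combination -h)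
  have hX := (w.isOPS_poly.monic 1).eq_X_add_C (w.isOPS_poly.natDegree_eq 1)
  set z := (w.poly 1).coeff 0
  have h10 : w.form (w.poly 1) 1 = 0 := by
    rw [← w.poly_zero]
    exact w.isOPS_poly.orthogonal 1 0 one_ne_zero
  have h20 : w.form (w.poly 2) 1 = 0 := by
    rw [← w.poly_zero]
    exact w.isOPS_poly.orthogonal 2 0 two_ne_zero
  have h5 : w.form (w.poly 1) (w.poly 1) = w.form (w.poly 1) X := by
    have hX' : w.poly 1 = X + z • (1 : ℂ[X]) := by rw [hX, smul_eq_C_mul, mul_one]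
    calc _ = w.form (w.poly 1) (X + z • (1 : ℂ[X])) := congrArg (w.form (w.poly 1)) hX'
      _ = _ := by rw [map_add, LinearMap.map_smulₛₗ, h10, smul_zero, add_zero]
  -- Since `P₁` is orthogonal to `1`, its norm is `⟨P₁ x, 1⟩ = ⟨P₁², 1⟩ = ⟨P₂, 1⟩`.
  have h6 : w.form (w.poly 1) (w.poly 1) = 0 := by
    rw [h5, ← one_mul X, ← w.isPolyInner_form.mul_X, ← h20, h3]
    have : w.poly 1 * w.poly 1 = w.poly 1 * X + z • w.poly 1 := by
      conv_lhs => rhs; rw [hX]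
      rw [smul_eq_C_mul]
      ring
    rw [this, map_add, LinearMap.add_apply, map_smul, LinearMap.smul_apply, h10]
    simp
  exact w.isOPS_poly.ne_zero 1 (w.isPolyInner_form.definite _ h6)

theorem IsHom.exists_adjoint {v w : ClassicalWeight} {V : PolyEnd} (hV : IsFiniteOrder V)
    {c : ℕ → ℂ} (hc : ∀ n, V (v.poly n) = c n • w.poly n) :
    ∃ (U : PolyEnd) (d : ℕ → ℂ), IsFiniteOrder U ∧ (∀ n, U (w.poly n) = d n • v.poly n) ∧
      ∀ n, d n = 0 ↔ c n = 0 :=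
  v.isOPS_poly.exists_adjoint v.isPolyInner_form w.isPolyInner_form w.isOPS_poly hV hc

/-- The first-order parts of the operators of two Jacobi weights with the same orthogonal
polynomials have the same slope. -/
theorem add_eq_add_of_poly_eq {a b a' b' : ℝ} {ha : -1 < a} {hb : -1 < b} {ha' : -1 < a'}
    {hb' : -1 < b'} (h : (jacobi a b ha hb).poly = (jacobi a' b' ha' hb').poly) :
    a + b = a' + b' := by
  set v := jacobi a b ha hb with hv
  set w := jacobi a' b' ha' hb' with hw
  by_contra hne
  set z : ℂ := ((a' + b' - (a + b) : ℝ) : ℂ) with hz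
  have hz0 : z ≠ 0 := by
    rw [hz, Complex.ofReal_ne_zero]
    exact sub_ne_zero.2 (Ne.symm hne)
  -- Subtracting the two eigenvalue equations cancels the second-order terms. Degree one then
  -- identifies the difference of the `b`'s, and degree two is contradictory.
  have h1 : ∀ n, derivative (v.poly n) * (v.bPoly - w.bPoly) = (z * n) • v.poly n := by
    intro n
    have h2 := v.deltaEnd_poly n
    have h3 := w.deltaEnd_poly n
    rw [← h, deltaEnd_apply] at h3
    rw [deltaEnd_apply] at h2
    have h4 : v.aPoly = w.aPoly := rfl
    have h5 : z * n = v.eig n - w.eig n := by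
      simp only [hz, eig, hv, hw]
      push_cast
      ring
    rw [h5, sub_smul, ← h2, ← h3, h4]
    ring
  have hb : v.bPoly - w.bPoly = z • v.poly 1 := by
    have h2 := h1 1
    have h3 := (v.isOPS_poly.monic 1).eq_X_add_C (v.isOPS_poly.natDegree_eq 1)
    have hd1 : derivative (v.poly 1) = 1 := by rw [h3]; simp
    rw [hd1, one_mul] at h2
    simpa using h2
  refine v.derivative_poly_two_mul_poly_one_ne ?_
  have h2 := h1 2
  rw [hb, smul_eq_C_mul, smul_eq_C_mul, C_mul] at h2
  refine mul_left_cancel₀ (C_ne_zero.2 hz0) ?_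
  simp only [Nat.cast_ofNat, C_two] at h2
  linear_combination h2

/-- Let `U` be the adjoint of `V`. Then `U V` and `V U` are polynomials in the two δ with the same
eigenvalues, so one polynomial in `n` is symmetric under both `n ↦ -s - n` and `n ↦ -t - n`. If the
sums differ it is constant, `U V` is a nonzero scalar, and `V` is multiplication by a constant. The
weights then share their orthogonal polynomials, which `add_eq_add_of_poly_eq` rules out. -/
theorem IsHom.add_eq_add {a b a' b' : ℝ} {ha : -1 < a} {hb : -1 < b} {ha' : -1 < a'}
    {hb' : -1 < b'} {V : PolyEnd} (hV : IsHom (jacobi a b ha hb) (jacobi a' b' ha' hb') V)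
    (hV0 : V ≠ 0) : a + b = a' + b' := by
  set v := jacobi a b ha hb with hv
  set w := jacobi a' b' ha' hb' with hw
  by_contra hne
  obtain ⟨hVf, c, hc⟩ := id hV
  obtain ⟨U, d, hUf, hd, hdc⟩ := IsHom.exists_adjoint hVf hc
  have hU : IsHom w v U := ⟨hUf, d, hd⟩
  obtain ⟨p, hp⟩ := (hU.mul hV).exists_aeval
  obtain ⟨q, hq⟩ := (hV.mul hU).exists_aeval
  have hp' : ∀ n, p.eval (v.eig n) = c n * d n := by
    intro n
    have h1 := congrArg (fun T : PolyEnd => T (v.poly n)) hp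
    simp only [Module.End.mul_apply, hc, map_smul, hd, aeval_deltaEnd_poly, smul_smul] at h1
    exact (smul_left_injective ℂ (v.isOPS_poly.ne_zero n) h1).symm
  have hq' : ∀ n, q.eval (w.eig n) = c n * d n := by
    intro n
    have h1 := congrArg (fun T : PolyEnd => T (w.poly n)) hq
    simp only [Module.End.mul_apply, hc, map_smul, hd, aeval_deltaEnd_poly, smul_smul] at h1
    rw [mul_comm]
    exact (smul_left_injective ℂ (w.isOPS_poly.ne_zero n) h1).symm
  set s : ℂ := a + b + 1 with hs
  set t : ℂ := a' + b' + 1 with ht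
  have hst : s ≠ t := by
    rw [hs, ht]
    exact_mod_cast fun h : a + b + 1 = a' + b' + 1 => hne (by linarith)
  set r : ℂ[X] := p.comp (-(X * (X + C s))) with hr
  have hrq : r = q.comp (-(X * (X + C t))) := by
    refine eq_of_infinite_eval_eq _ _ ((Set.infinite_range_of_injective
      (f := fun n : ℕ => (n : ℂ)) Nat.cast_injective).mono ?_)
    rintro _ ⟨n, rfl⟩
    have h1 := (hp' n).trans (hq' n).symm
    simp only [eig, hv, hw] at h1
    simpa [hr, hs, ht] using h1
  have hconst : r = C (r.eval 0) := by
    refine eq_C_of_two_reflections hst (fun x => ?_) (fun x => ?_)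
    · simp only [hr, eval_comp, eval_neg, eval_mul, eval_X, eval_add, eval_C]
      congr 1
      ring
    · rw [hrq]
      simp only [eval_comp, eval_neg, eval_mul, eval_X, eval_add, eval_C]
      congr 1
      ring
  set κ := r.eval 0
  have hκ : ∀ n, c n * d n = κ := by
    intro n
    have h1 : r.eval (n : ℂ) = c n * d n := by
      rw [← hp']
      simp [hr, eig, hv, hs]
    rw [← h1, hconst, eval_C]
  -- `c n` and `d n` vanish together, so `κ = 0` would give `V = 0`.
  have hκ0 : κ ≠ 0 := by
    intro h0
    refine hV0 (v.isOPS_poly.end_ext fun n => ?_)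
    have h1 := hκ n
    rw [h0, mul_eq_zero, hdc, or_self] at h1
    simp [hc, h1]
  have hUV : U * V = κ • 1 := by
    refine v.isOPS_poly.end_ext fun n => ?_
    simp [hc, hd, smul_smul, hκ]
  have hU0 : U ≠ 0 := by
    rintro rfl
    have h1 := congrArg (fun T : PolyEnd => T 1) hUV
    exact smul_ne_zero hκ0 one_ne_zero h1.symm
  obtain ⟨k, f, hVk, hVf', hf⟩ := hVf.exists_order hV0
  obtain ⟨l, g, hUl, hUg, hg⟩ := hUf.exists_order hU0
  have htop := theta_pow_mul_top hUl hVk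
  -- The symbol of `U V` in order `l + k` is a nonzero multiple of `f g`, while a scalar has order
  -- zero.
  have hk : k = 0 := by
    by_contra hk
    obtain ⟨j, hj⟩ := Nat.exists_eq_succ_of_ne_zero (show l + k ≠ 0 by omega)
    have h1 : (theta ^ (j + 1)) (κ • 1) = 0 := by
      have : theta (1 : PolyEnd) = 0 := by simp [theta_apply]
      rw [theta_pow_succ, map_smul, this, smul_zero, map_zero]
    rw [hj, hUV, h1, ← hj, hUg, hVf', mulEnd_mul_mulEnd] at htop
    have h2 := congrArg (fun T : PolyEnd => T 1) htop
    have h3 : (l + k).choose l ≠ 0 := (Nat.choose_pos (by omega)).ne'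
    simp [hf, hg, h3] at h2
  subst hk
  have hVmul : ∀ p, V p = p * f := fun p => by
    have : V = mulEnd f := by simpa using hVf'
    rw [this]
    rfl
  have hf0 : f = C (c 0) := by
    have h1 := hc 0
    rw [hVmul, poly_zero, poly_zero, one_mul] at h1
    rw [h1, smul_eq_C_mul, mul_one]
  refine hne (add_eq_add_of_poly_eq (a := a) (b := b) (a' := a') (b' := b') (ha := ha) (hb := hb)
    (ha' := ha') (hb' := hb') (funext fun n => ?_))
  change v.poly n = w.poly n
  have h1 := hc n
  rw [hVmul, hf0, mul_comm, ← smul_eq_C_mul] at h1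
  have h2 := congrArg (fun p => p.coeff n) h1
  simp only [coeff_smul, v.isOPS_poly.coeff_self, w.isOPS_poly.coeff_self] at h2
  have h3 : c 0 = c n := by simpa using h2
  have h4 : c n ≠ 0 := fun h => hκ0 (by rw [← hκ n, h, zero_mul])
  rw [h3] at h1
  exact smul_right_injective _ h4 h1

theorem IsHom.eig_eq {v w : ClassicalWeight} (ht : v.type = w.type) {V : PolyEnd}
    (hV : IsHom v w V) (hV0 : V ≠ 0) : v.eig = w.eig := by
  rcases v with b | ⟨a, ha⟩ | ⟨a, b, ha, hb⟩ <;>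
    rcases w with b' | ⟨a', ha'⟩ | ⟨a', b', ha', hb'⟩ <;> simp only [type, reduceCtorEq] at ht
  · rfl
  · rfl
  · have h1 : (a : ℂ) + b = a' + b' := by exact_mod_cast hV.add_eq_add hV0
    funext n
    simp only [eig, h1]

/-! ### Weights that are linked by an invertible sequence of eigenvalues -/

/-- Some operator of finite order maps the orthogonal polynomials of `v` to nonzero multiples of
those of `w`. -/
def Linked (v w : ClassicalWeight) : Prop :=
  ∃ V : PolyEnd, IsFiniteOrder V ∧ ∃ c : ℕ → ℂ, (∀ n, c n ≠ 0) ∧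
    ∀ n, V (v.poly n) = c n • w.poly n

theorem Linked.refl (w : ClassicalWeight) : Linked w w :=
  ⟨1, isFiniteOrder_one, fun _ => 1, fun _ => one_ne_zero, fun _ => by simp⟩

theorem Linked.symm {v w : ClassicalWeight} (h : Linked v w) : Linked w v := by
  obtain ⟨V, hV, c, hc0, hc⟩ := h
  obtain ⟨U, d, hU, hd, hdc⟩ := IsHom.exists_adjoint hV hc
  exact ⟨U, hU, d, fun n => (hdc n).not.2 (hc0 n), hd⟩

theorem Linked.trans {u v w : ClassicalWeight} (h : Linked u v) (h' : Linked v w) :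
    Linked u w := by
  obtain ⟨V, hV, c, hc0, hc⟩ := h
  obtain ⟨U, hU, d, hd0, hd⟩ := h'
  exact ⟨U * V, hU.mul hV, fun n => c n * d n, fun n => mul_ne_zero (hc0 n) (hd0 n), fun n => by
    rw [Module.End.mul_apply, hc, map_smul, hd, smul_smul]⟩

/-- Target polynomials are monic, so the eigenvalue of `V` in degree `n` can be read off from the
leading term of the image. -/
theorem linked_of_comm {v w : ClassicalWeight} {V : PolyEnd} (hV : IsFiniteOrder V)
    (he : v.eig = w.eig) (h : V * v.deltaEnd = w.deltaEnd * V) {z : ℕ → ℂ} (hz : ∀ n, z n ≠ 0)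
    (hcoeff : ∀ n, (V (v.poly n)).coeff n = z n) : Linked v w := by
  obtain ⟨-, c, hc⟩ := isHom_of_comm hV he h
  refine ⟨V, hV, c, fun n hn => hz n ?_, hc⟩
  rw [← hcoeff, hc, hn]
  simp

/-! ### Contiguity relations and parameter shifts -/

theorem linked_laguerre_succ (a : ℝ) (ha : -1 < a) (ha' : -1 < a + 1) :
    Linked (laguerre a ha) (laguerre (a + 1) ha') := by
  refine linked_of_comm (V := 1 - derivative) (isFiniteOrder_one.sub isFiniteOrder_derivative) rfl
    ?_ (z := fun _ => 1) (fun _ => one_ne_zero) fun n => ?_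
  · refine LinearMap.ext fun p => ?_
    simp only [Module.End.mul_apply, LinearMap.sub_apply, Module.End.one_apply, deltaEnd_apply,
      aPoly, bPoly]
    simp
    ring
  · rw [LinearMap.sub_apply, Module.End.one_apply, coeff_sub, coeff_derivative,
      (laguerre a ha).isOPS_poly.coeff_self, coeff_eq_zero_of_natDegree_lt
      (by rw [(laguerre a ha).isOPS_poly.natDegree_eq]; omega)]
    simp

theorem linked_laguerre_add (n : ℕ) (a a' : ℝ) (ha : -1 < a) (ha' : -1 < a') (h : a' = a + n) :
    Linked (laguerre a ha) (laguerre a' ha') := by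
  induction n generalizing a' with
  | zero =>
    obtain rfl : a' = a := by simpa using h
    exact Linked.refl _
  | succ n ih =>
    have hn : (0 : ℝ) ≤ n := n.cast_nonneg
    obtain rfl : a' = a + n + 1 := by rw [h]; push_cast; ring
    exact (ih (a + n) (by linarith) rfl).trans (linked_laguerre_succ _ _ _)

/-- The classical contiguity operator `(1 + x) ∂ + (b + 1)` trades one unit of `b` for one of `a`,
which keeps the sum and hence the eigenvalues. -/
theorem linked_jacobi_succ (a b : ℝ) (ha : -1 < a) (hb : -1 < b + 1) (ha' : -1 < a + 1)
    (hb' : -1 < b) : Linked (jacobi a (b + 1) ha hb) (jacobi (a + 1) b ha' hb') := by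
  refine linked_of_comm (V := mulEnd (1 + X) * derivative + ((b : ℂ) + 1) • 1)
    (((isFiniteOrder_mulEnd _).mul isFiniteOrder_derivative).add (isFiniteOrder_one.smul _))
    (by funext n; simp only [eig]; push_cast; ring)
    ?_ (z := fun n => n + (b + 1)) (fun n => ?_) fun n => ?_
  · refine LinearMap.ext fun p => ?_
    simp only [Module.End.mul_apply, LinearMap.add_apply, LinearMap.smul_apply,
      LinearMap.mulRight_apply, Module.End.one_apply, deltaEnd_apply, aPoly, bPoly, smul_eq_C_mul]
    simp [C_two]
    ring
  · have hn : (0 : ℝ) ≤ n := n.cast_nonneg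
    have : (n : ℝ) + (b + 1) ≠ 0 := by linarith
    exact_mod_cast this
  · rw [LinearMap.add_apply, Module.End.mul_apply, LinearMap.mulRight_apply, LinearMap.smul_apply,
      Module.End.one_apply, mul_add, mul_one, coeff_add, coeff_add, coeff_derivative_mul_X,
      coeff_smul, coeff_derivative, IsOPS.coeff_self (isOPS_poly _), coeff_eq_zero_of_natDegree_lt
      (by rw [IsOPS.natDegree_eq (isOPS_poly _)]; omega)]
    simp

theorem linked_jacobi_add (n : ℕ) (a b a' b' : ℝ) (ha : -1 < a) (hb : -1 < b) (ha' : -1 < a')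
    (hb' : -1 < b') (h : a' = a + n) (h' : b = b' + n) :
    Linked (jacobi a b ha hb) (jacobi a' b' ha' hb') := by
  induction n generalizing a' b' with
  | zero =>
    obtain rfl : a' = a := by simpa using h
    obtain rfl : b = b' := by simpa using h'
    exact Linked.refl _
  | succ n ih =>
    have hn : (0 : ℝ) ≤ n := n.cast_nonneg
    obtain rfl : a' = a + n + 1 := by rw [h]; push_cast; ring
    exact (ih (a + n) (b' + 1) (by linarith) (by linarith) rfl (by rw [h']; push_cast; ring)).trans
      (linked_jacobi_succ _ _ _ _ _ _)

theorem linked_of_isHom_hermite {b b' : ℝ} {f : ℂ[X]} (hf : f ≠ 0) {k : ℕ}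
    (h : 2 * (hermite b).aPoly * derivative f = (C (k : ℂ) * derivative (hermite b).aPoly
      + ((hermite b).bPoly - (hermite b').bPoly)) * f) :
    Linked (hermite b) (hermite b') := by
  have h1 : derivative f = C ((b : ℂ) - b') * f := by
    refine mul_left_cancel₀ (two_ne_zero (α := ℂ[X])) ?_
    simp only [aPoly, bPoly, derivative_one, C_sub] at h ⊢
    linear_combination h
  -- A nonzero polynomial cannot be a nonzero multiple of its own derivative's degree-lowered image:
  -- `f' = (b - b') f` contradicts degrees unless `b = b'`.
  have h2 : (b : ℂ) - b' = 0 := by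
    by_contra hne
    have h3 := degree_derivative_lt hf
    rw [h1, degree_C_mul hne] at h3
    exact lt_irrefl _ h3
  obtain rfl : b = b' := by exact_mod_cast sub_eq_zero.1 h2
  exact Linked.refl _

theorem linked_of_isHom_laguerre {a a' : ℝ} {ha : -1 < a} {ha' : -1 < a'} {f : ℂ[X]} (hf : f ≠ 0)
    {k : ℕ} (h : 2 * (laguerre a ha).aPoly * derivative f
      = (C (k : ℂ) * derivative (laguerre a ha).aPoly
        + ((laguerre a ha).bPoly - (laguerre a' ha').bPoly)) * f) :
    Linked (laguerre a ha) (laguerre a' ha') := by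
  have h1 := indicial_equation hf h (r := 0) (by simp [aPoly])
  simp [aPoly, bPoly] at h1
  set m := f.rootMultiplicity 0
  -- The indicial equation at `0` makes `a' - a` the integer `k - 2m`; its sign decides the
  -- direction of the chain.
  have h2 : a' + 2 * m = a + k := by
    have : (a' : ℂ) + 2 * m = a + k := by linear_combination h1
    exact_mod_cast this
  rcases le_total (2 * m) k with hmk | hmk
  · obtain ⟨n, rfl⟩ := Nat.exists_eq_add_of_le hmk
    refine linked_laguerre_add n _ _ _ _ ?_
    push_cast at h2
    linarith
  · obtain ⟨n, hn⟩ := Nat.exists_eq_add_of_le hmk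
    refine (linked_laguerre_add n _ _ _ _ ?_).symm
    have : (2 * m : ℝ) = k + n := by exact_mod_cast hn
    linarith

theorem linked_of_isHom_jacobi {a b a' b' : ℝ} {ha : -1 < a} {hb : -1 < b} {ha' : -1 < a'}
    {hb' : -1 < b'} (hab : a + b = a' + b') {f : ℂ[X]} (hf : f ≠ 0) {k : ℕ}
    (h : 2 * (jacobi a b ha hb).aPoly * derivative f
      = (C (k : ℂ) * derivative (jacobi a b ha hb).aPoly
        + ((jacobi a b ha hb).bPoly - (jacobi a' b' ha' hb').bPoly)) * f) :
    Linked (jacobi a b ha hb) (jacobi a' b' ha' hb') := by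
  have h1 := indicial_equation hf h (r := 1) (by simp [aPoly])
  have h2 := indicial_equation hf h (r := -1) (by simp [aPoly])
  generalize f.rootMultiplicity 1 = m at h1
  generalize f.rootMultiplicity (-1) = q at h2
  simp [aPoly, bPoly] at h1 h2
  have h1' : (2 : ℝ) * (-1 + -1) * m
      = k * (-1 + -1) + (b - a - (a + b + 2) - (b' - a' - (a' + b' + 2))) := by
    exact_mod_cast h1
  have h2' : (2 : ℝ) * (1 + 1) * q
      = k * (1 + 1) + (b - a + (a + b + 2) - (b' - a' + (a' + b' + 2))) := by
    apply Complex.ofReal_injective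
    push_cast
    linear_combination h2
  -- The indicial equations read `2m = k + a - a'` and `2q = k + b - b'`. With `a + b = a' + b'`
  -- they give `a' - a = q - m = b - b'`.
  rcases le_total m q with hmq | hmq
  · obtain ⟨n, hn⟩ := Nat.exists_eq_add_of_le hmq
    have hn' : (q : ℝ) = m + n := by exact_mod_cast hn
    exact linked_jacobi_add n _ _ _ _ _ _ _ _ (by linarith) (by linarith)
  · obtain ⟨n, hn⟩ := Nat.exists_eq_add_of_le hmq
    have hn' : (m : ℝ) = q + n := by exact_mod_cast hn
    exact (linked_jacobi_add n _ _ _ _ _ _ _ _ (by linarith) (by linarith)).symm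

/-- Two classical weights of the same type with a nonzero operator between them are linked. -/
theorem IsHom.linked {v w : ClassicalWeight} (ht : v.type = w.type) {V : PolyEnd}
    (hV : IsHom v w V) (hV0 : V ≠ 0) : Linked v w := by
  obtain ⟨k, f, -, hVf, hf⟩ := hV.1.exists_order hV0
  have hcomm := hV.comm_delta (hV.eig_eq ht hV0)
  rw [deltaEnd_eq_secondOrder, deltaEnd_eq_secondOrder] at hcomm
  cases v <;> cases w <;> simp only [type, reduceCtorEq] at ht
  · exact linked_of_isHom_hermite hf (symbol_equation hVf hcomm)
  · exact linked_of_isHom_laguerre hf (symbol_equation hVf hcomm)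
  · exact linked_of_isHom_jacobi (hV.add_eq_add hV0) hf (symbol_equation hVf hcomm)

end ClassicalWeight

/-! ### Diagonal weight matrices -/

section Diagonal

variable {n : Type*} [Fintype n] [DecidableEq n] (w : n → ClassicalWeight)

theorem innerW_diagWeight_apply (P Q : Matrix n n ℂ[X]) (i j : n) :
    innerW (diagWeight w) P Q i j = ∑ l, (w l).form (P i l) (Q j l) := by
  simp only [ClassicalWeight.form_apply]
  rw [← MeasureTheory.integral_finsetSum _ fun l _ => (w l).integrable_form _ _]
  simp only [innerW, Matrix.of_apply]
  refine MeasureTheory.integral_congr_ae (Filter.Eventually.of_forall fun x => ?_)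
  simp only
  rw [Matrix.mul_apply]
  refine Finset.sum_congr rfl fun l _ => ?_
  rw [diagWeight, Matrix.mul_diagonal]
  rfl

/-- The diagonal matrix of the monic orthogonal polynomials of the entries of the weight. -/
def diagPoly (k : ℕ) : Matrix n n ℂ[X] := Matrix.diagonal fun j => (w j).poly k

theorem coeff_matPolyEquiv_diagPoly (k m : ℕ) :
    (matPolyEquiv (diagPoly w k)).coeff m
      = Matrix.diagonal fun j => ((w j).poly k).coeff m := by
  ext i j
  rw [matPolyEquiv_coeff_apply, diagPoly]
  rcases eq_or_ne i j with rfl | h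
  · simp
  · simp [h]

theorem isMonicOrthogonalSeq_diagPoly : IsMonicOrthogonalSeq (diagWeight w) (diagPoly w) := by
  have h1 : ∀ k, (matPolyEquiv (diagPoly w k)).coeff k = 1 := fun k => by
    rw [coeff_matPolyEquiv_diagPoly]
    simp [(ClassicalWeight.isOPS_poly _).coeff_self]
  refine ⟨⟨fun k => ?_, fun k => by rw [h1]; exact isUnit_one, fun k l hkl => ?_⟩, h1⟩
  · rw [natDegree_le_iff_coeff_eq_zero]
    intro m hm
    rw [coeff_matPolyEquiv_diagPoly]
    have : ∀ j, ((w j).poly k).coeff m = 0 := fun j =>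
      coeff_eq_zero_of_natDegree_lt (by rwa [(w j).isOPS_poly.natDegree_eq])
    simp [this]
  · ext i j
    rw [innerW_diagWeight_apply]
    refine Finset.sum_eq_zero fun x _ => ?_
    simp only [diagPoly, Matrix.diagonal_apply]
    split_ifs with h h' h'
    · subst h h'
      exact (w _).isOPS_poly.orthogonal k l hkl
    all_goals simp

variable {w}

theorem IsOrthogonalSeq.innerW_eq_zero {Q : ℕ → Matrix n n ℂ[X]}
    (hQ : IsOrthogonalSeq (diagWeight w) Q) {k : ℕ} {R : Matrix n n ℂ[X]}
    (hR : ∀ i l, (R i l).degree < k) : innerW (diagWeight w) (Q k) R = 0 := by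
  have key : ∀ j ≤ k, ∀ R : Matrix n n ℂ[X], (∀ i l, (R i l).degree < j) →
      innerW (diagWeight w) (Q k) R = 0 := by
    intro j
    induction j with
    | zero =>
      intro _ R hR
      have hR0 : ∀ i l, R i l = 0 := fun i l => by
        rw [← degree_eq_bot]
        exact Nat.WithBot.lt_zero_iff.1 (by simpa using hR i l)
      ext i l
      simp [innerW_diagWeight_apply, hR0]
    | succ j ih =>
      intro hj R hR
      obtain ⟨u, hu⟩ := hQ.isUnit_coeff j
      -- Chosen so that `A` times `Q j` cancels the degree-`j` coefficient of `R`.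
      set A : Matrix n n ℂ := (matPolyEquiv R).coeff j * (u⁻¹ : (Matrix n n ℂ)ˣ) with hA
      have hR' : ∀ i l, ((R - A.map C * Q j) i l).degree < j := by
        intro i l
        rw [degree_lt_iff_coeff_zero]
        intro m hm
        have hcoef : (matPolyEquiv (A.map C * Q j)).coeff m = A * (matPolyEquiv (Q j)).coeff m := by
          rw [map_mul, matPolyEquiv_map_C, coeff_C_mul]
        have h1 : ((A.map C * Q j) i l).coeff m = (A * (matPolyEquiv (Q j)).coeff m) i l := by
          rw [← hcoef, matPolyEquiv_coeff_apply]
        rw [Matrix.sub_apply, coeff_sub, h1]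
        rcases hm.eq_or_lt with rfl | hlt
        · rw [hA, ← hu, mul_assoc, Units.inv_mul, mul_one, matPolyEquiv_coeff_apply, sub_self]
        · rw [coeff_eq_zero_of_natDegree_lt ((hQ.natDegree_le j).trans_lt hlt), mul_zero,
            (degree_lt_iff_coeff_zero _ _).1 (hR i l) m hlt]
          simp
      have h2 := ih (by omega) _ hR'
      have h3 := hQ.orthogonal k j (by omega)
      ext i l
      have h4 := congrFun (congrFun h2 i) l
      rw [innerW_diagWeight_apply] at h4 ⊢
      have h5 : ∑ x, (w x).form (Q k i x) ((A.map C * Q j) l x) = 0 := by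
        simp only [Matrix.mul_apply, Matrix.map_apply, map_sum, ← smul_eq_C_mul,
          LinearMap.map_smulₛₗ]
        rw [Finset.sum_comm]
        refine Finset.sum_eq_zero fun y _ => ?_
        have h6 := congrFun (congrFun h3 i) y
        rw [innerW_diagWeight_apply] at h6
        rw [← Finset.smul_sum, h6]
        simp
      simp only [Matrix.sub_apply, map_sub, Finset.sum_sub_distrib] at h4
      rw [h5, sub_zero] at h4
      exact h4
  exact key k le_rfl R hR

theorem IsOrthogonalSeq.eq_mul_diagPoly {Q : ℕ → Matrix n n ℂ[X]}
    (hQ : IsOrthogonalSeq (diagWeight w) Q) (k : ℕ) :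
    Q k = ((matPolyEquiv (Q k)).coeff k).map C * diagPoly w k := by
  ext1 i l
  rw [diagPoly, Matrix.mul_diagonal, Matrix.map_apply, matPolyEquiv_coeff_apply, ← smul_eq_C_mul]
  refine (w l).isOPS_poly.eq_smul (w l).isPolyInner_form ?_ fun r hr => ?_
  · rw [natDegree_le_iff_coeff_eq_zero]
    intro m hm
    rw [← matPolyEquiv_coeff_apply,
      coeff_eq_zero_of_natDegree_lt ((hQ.natDegree_le k).trans_lt hm), Matrix.zero_apply]
  -- A test matrix supported in column `l` isolates the form of `w l`.
  · have h1 := hQ.innerW_eq_zero (R := Matrix.of fun _ x => if x = l then r else 0) (k := k)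
      (fun i x => by
        rw [Matrix.of_apply]
        split_ifs
        · exact hr
        · simp)
    have h2 := congrFun (congrFun h1 i) i
    rw [innerW_diagWeight_apply, Finset.sum_eq_single l] at h2
    · simpa using h2
    · intro x _ hx
      simp [hx]
    · simp

theorem IsMonicOrthogonalSeq.eq_diagPoly {Q : ℕ → Matrix n n ℂ[X]}
    (hQ : IsMonicOrthogonalSeq (diagWeight w) Q) (k : ℕ) : Q k = diagPoly w k := by
  have := hQ.toIsOrthogonalSeq.eq_mul_diagPoly k
  rwa [hQ.coeff_eq_one, Matrix.map_one C C_0 C_1, one_mul] at this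

theorem act_diagPoly_apply (D : DiffOp n) (k : ℕ) (i j : n) :
    act (diagPoly w k) D i j = (D i j).1.unop ((w i).poly k) := by
  simp only [act, Matrix.of_apply, diagPoly]
  rw [Finset.sum_eq_single i]
  · simp
  · intro b _ hb
    simp [Matrix.diagonal_apply_ne _ hb.symm]
  · simp

theorem map_C_mul_diagPoly_apply (L : Matrix n n ℂ) (k : ℕ) (i j : n) :
    (L.map C * diagPoly w k) i j = L i j • (w j).poly k := by
  rw [diagPoly, Matrix.mul_diagonal, Matrix.map_apply, smul_eq_C_mul]

/-- The algebra of a diagonal weight consists of the matrices of operators that map the orthogonal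
polynomials of one entry to multiples of those of another one. -/
theorem mem_algD_diagWeight_iff (D : DiffOp n) :
    D ∈ algD (diagWeight w) ↔ ∀ i j, (w i).IsHom (w j) (D i j).1.unop := by
  constructor
  · intro hD i j
    choose L hL using hD _ (isMonicOrthogonalSeq_diagPoly w).toIsOrthogonalSeq
    refine ⟨isFiniteOrder_unop _, fun k => L k i j, fun k => ?_⟩
    rw [← act_diagPoly_apply, hL, map_C_mul_diagPoly_apply]
  · intro h Q hQ k
    choose c hc using fun i j => (h i j).2
    have hact : act (diagPoly w k) D = (Matrix.of fun i j => c i j k).map C * diagPoly w k := by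
      ext1 i j
      rw [act_diagPoly_apply, map_C_mul_diagPoly_apply, hc, Matrix.of_apply]
    obtain ⟨u, hu⟩ := hQ.isUnit_coeff k
    -- `Q k` is its leading coefficient `u` times the diagonal sequence, so the eigenvalue is
    -- conjugated by `u`.
    refine ⟨u * (Matrix.of fun i j => c i j k) * (u⁻¹ : (Matrix n n ℂ)ˣ), ?_⟩
    have hQk := hQ.eq_mul_diagPoly k
    rw [← hu] at hQk
    have hinv : ((u⁻¹ : (Matrix n n ℂ)ˣ) : Matrix n n ℂ).map C
        * (u : Matrix n n ℂ).map C = (1 : Matrix n n ℂ[X]) := by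
      rw [← Matrix.map_mul, Units.inv_mul, Matrix.map_one C C_0 C_1]
    rw [hQk, act_const_mul, hact, Matrix.map_mul, Matrix.map_mul]
    simp only [mul_assoc]
    rw [← mul_assoc (((u⁻¹ : (Matrix n n ℂ)ˣ) : Matrix n n ℂ).map C), hinv, one_mul]

end Diagonal

/-! ### Operators as endomorphisms -/

theorem Omega.ext_unop {D E : Omega} (h : D.1.unop = E.1.unop) : D = E :=
  Subtype.ext (MulOpposite.unop_injective h)

theorem IsFiniteOrder.exists_omega {T : PolyEnd} (hT : IsFiniteOrder T) :
    ∃ D : Omega, D.1.unop = T :=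
  ⟨⟨MulOpposite.op T, (isDiffOp_op_iff T).2 hT⟩, rfl⟩

theorem aeval_omega_unop (D : Omega) (q : ℂ[X]) :
    (aeval D q).1.unop = aeval (D.1.unop : PolyEnd) q := by
  induction q using Polynomial.induction_on' with
  | add p q hp hq => rw [map_add, map_add, ← hp, ← hq]; rfl
  | monomial k c =>
    rw [aeval_monomial, aeval_monomial, ← Algebra.smul_def, ← Algebra.smul_def]
    change c • (D ^ k).1.unop = _
    rw [SubmonoidClass.coe_pow, MulOpposite.unop_pow]

namespace ClassicalWeight

theorem isHom_zero (v w : ClassicalWeight) : IsHom v w 0 :=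
  ⟨⟨0, by simp⟩, fun _ => 0, fun _ => by simp⟩

theorem isHom_one (w : ClassicalWeight) : IsHom w w 1 := by
  simpa using w.isHom_aeval 1

/-! ### Darboux equivalence -/

theorem degree_apply_eq {v w : ClassicalWeight} {V : PolyEnd} (hV : IsFiniteOrder V) {c : ℕ → ℂ}
    (hc0 : ∀ n, c n ≠ 0) (hc : ∀ n, V (v.poly n) = c n • w.poly n) (p : ℂ[X]) :
    (V p).degree = p.degree := by
  by_cases hp : p = 0
  · simp [hp]
  set n := p.natDegree with hn
  have hlt := natDegree_sub_smul_lt (v.isOPS_poly.monic n) (v.isOPS_poly.natDegree_eq n) hn.ge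
  have h1 : p.coeff n ≠ 0 := by rwa [hn, coeff_natDegree, leadingCoeff_ne_zero]
  have h2 : V p = (p.coeff n * c n) • w.poly n + V (p - p.coeff n • v.poly n) := by
    rw [map_sub, map_smul, hc, smul_smul]
    abel
  have h3 : ((p.coeff n * c n) • w.poly n).degree = (n : WithBot ℕ) := by
    rw [smul_eq_C_mul, degree_C_mul (mul_ne_zero h1 (hc0 n)),
      degree_eq_natDegree (w.isOPS_poly.ne_zero n), w.isOPS_poly.natDegree_eq]
  rw [h2, degree_add_eq_left_of_degree_lt, h3, degree_eq_natDegree hp]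
  rw [h3]
  exact IsHom.degree_lt (v := v) (w := w) ⟨hV, c, hc⟩ hlt

theorem degree_matPolyEquiv_fin_one (M : Matrix (Fin 1) (Fin 1) ℂ[X]) :
    (matPolyEquiv M).degree = (M 0 0).degree := by
  have h : ∀ m, (matPolyEquiv M).coeff m = 0 ↔ (M 0 0).coeff m = 0 := fun m => by
    rw [← matPolyEquiv_coeff_apply, ← Matrix.ext_iff]
    simp
  refine le_antisymm ((degree_le_iff_coeff_zero _ _).2 fun m hm => ?_)
    ((degree_le_iff_coeff_zero _ _).2 fun m hm => ?_)
  · exact (h m).2 (coeff_eq_zero_of_degree_lt hm)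
  · exact (h m).1 (coeff_eq_zero_of_degree_lt hm)

theorem isDegreePreserving_fin_one {v w : ClassicalWeight} {D : Omega} {c : ℕ → ℂ}
    (hc0 : ∀ n, c n ≠ 0) (hc : ∀ n, D.1.unop (v.poly n) = c n • w.poly n) :
    IsDegreePreserving (Matrix.of fun _ _ : Fin 1 => D) := by
  intro P
  rw [degree_matPolyEquiv_fin_one, degree_matPolyEquiv_fin_one]
  simp only [act, Matrix.of_apply, Finset.univ_unique, Fin.default_eq_zero, Finset.sum_singleton]
  exact degree_apply_eq (isFiniteOrder_unop D) hc0 hc _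

/-- Preserving degrees is what keeps the eigenvalues of `V` nonzero. Conversely, the adjoint of a
link serves as the second factor, since its eigenvalues are nonzero too. -/
theorem darbouxEquiv_iff_linked (v w : ClassicalWeight) : DarbouxEquiv v w ↔ Linked v w := by
  constructor
  · rintro ⟨V, N, -, hV, -, h⟩
    choose A hA using h _ _ (isMonicOrthogonalSeq_diagPoly _) (isMonicOrthogonalSeq_diagPoly _)
    have hA' : ∀ k, (V 0 0).1.unop (v.poly k) = A k 0 0 • w.poly k := fun k => by
      have h1 := congrFun (congrFun (hA k) 0) 0
      rwa [act_diagPoly_apply, map_C_mul_diagPoly_apply] at h1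
    refine ⟨(V 0 0).1.unop, isFiniteOrder_unop _, fun k => A k 0 0, fun k hk => ?_, hA'⟩
    have h1 := hV (diagPoly (fun _ : Fin 1 => v) k)
    rw [degree_matPolyEquiv_fin_one, degree_matPolyEquiv_fin_one, act_diagPoly_apply, hA',
      show A k 0 0 = 0 from hk,
      zero_smul, degree_zero] at h1
    exact v.isOPS_poly.ne_zero k (degree_eq_bot.1 (by simpa [diagPoly] using h1.symm))
  · rintro ⟨V, hV, c, hc0, hc⟩
    obtain ⟨U, d, hU, hd, hdc⟩ := IsHom.exists_adjoint hV hc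
    obtain ⟨D, rfl⟩ := hV.exists_omega
    obtain ⟨E, rfl⟩ := hU.exists_omega
    refine ⟨Matrix.of fun _ _ => D, Matrix.of fun _ _ => E, ?_,
      isDegreePreserving_fin_one hc0 hc,
      isDegreePreserving_fin_one (fun n => (hdc n).not.2 (hc0 n)) hd, ?_⟩
    · rw [mem_algD_diagWeight_iff]
      intro i j
      have h1 : ((Matrix.of fun _ _ : Fin 1 => D) * (Matrix.of fun _ _ : Fin 1 => E)) i j
          = D * E := by
        simp [Matrix.mul_apply]
      rw [h1]
      -- Operators act on the right, so `D * E` is `E` after `D` as an endomorphism.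
      exact IsHom.mul (v := w) ⟨hU, d, hd⟩ ⟨hV, c, hc⟩
    · intro P P' hP hP' k
      refine ⟨Matrix.of fun _ _ => c k, ?_⟩
      rw [hP.eq_diagPoly, hP'.eq_diagPoly]
      ext1 i j
      rw [act_diagPoly_apply, map_C_mul_diagPoly_apply]
      exact hc k

end ClassicalWeight

/-! ### The center -/

section Center

variable {n : Type*} [Fintype n] [DecidableEq n] {w : n → ClassicalWeight}

theorem mem_centerD_iff {W : ℝ → Matrix n n ℂ} {D : DiffOp n} :
    D ∈ centerD W ↔ D ∈ algD W ∧ ∀ E ∈ algD W, E * D = D * E := by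
  rw [centerD, Subalgebra.mem_map]
  constructor
  · rintro ⟨D, hD, rfl⟩
    rw [Subalgebra.mem_center_iff] at hD
    exact ⟨D.2, fun E hE => congrArg Subtype.val (hD ⟨E, hE⟩)⟩
  · rintro ⟨hD, h⟩
    exact ⟨⟨D, hD⟩, Subalgebra.mem_center_iff.2 fun E => Subtype.ext (h E.1 E.2), rfl⟩

theorem single_mem_algD {i j : n} {D : Omega} (hD : (w i).IsHom (w j) D.1.unop) :
    Matrix.single i j D ∈ algD (diagWeight w) := by
  rw [mem_algD_diagWeight_iff]
  intro a b
  by_cases h : i = a ∧ j = b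
  · obtain ⟨rfl, rfl⟩ := h
    rwa [Matrix.single_apply_same]
  · rw [Matrix.single_apply_of_ne _ _ _ _ _ h]
    exact ClassicalWeight.isHom_zero _ _

/-- The center of the algebra of a diagonal classical weight: diagonal operators with entries
`p i (δ i)`, with the same polynomial for linked entries. -/
theorem mem_centerD_diagWeight_iff (htype : ∀ i j, (w i).type = (w j).type) {D : DiffOp n} :
    D ∈ centerD (diagWeight w) ↔ ∃ p : n → ℂ[X],
      D = Matrix.diagonal (fun j => aeval (w j).delta (p j)) ∧
        ∀ i j, (w i).Linked (w j) → p i = p j := by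
  rw [mem_centerD_iff]
  constructor
  · rintro ⟨hD, hcomm⟩
    rw [mem_algD_diagWeight_iff] at hD
    choose p hp using fun i => (hD i i).exists_aeval
    have hdiag : D = Matrix.diagonal fun j => aeval (w j).delta (p j) := by
      ext1 i j
      rcases eq_or_ne i j with rfl | hij
      · rw [Matrix.diagonal_apply_eq]
        refine Omega.ext_unop ?_
        rw [hp, aeval_omega_unop]
        rfl
      · rw [Matrix.diagonal_apply_ne _ hij]
        -- Commuting with the diagonal matrix unit at `i` kills the off-diagonal entries of row `i`.
        have h1 := hcomm _ (single_mem_algD (i := i) (j := i) (D := 1) (w i).isHom_one)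
        have h2 := congrFun (congrFun h1 i) j
        rwa [Matrix.single_mul_apply_same, one_mul,
          Matrix.mul_single_apply_of_ne _ _ _ _ _ hij.symm]
          at h2
    refine ⟨p, hdiag, fun i j hij => ?_⟩
    obtain ⟨V, hV, c, hc0, hc⟩ := hij
    have hVhom : (w i).IsHom (w j) V := ⟨hV, c, hc⟩
    have hV0 : V ≠ 0 := by
      rintro rfl
      have h1 := (hc 0).symm
      rw [LinearMap.zero_apply, smul_eq_zero] at h1
      exact h1.elim (hc0 0) ((w j).isOPS_poly.ne_zero 0)
    have heig := hVhom.eig_eq (htype i j) hV0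
    obtain ⟨E, rfl⟩ := hV.exists_omega
    have h1 := congrFun (congrFun (hcomm _ (single_mem_algD hVhom)) i) j
    rw [Matrix.single_mul_apply_same, Matrix.mul_single_apply_same] at h1
    have h2 : ∀ k, (p i).eval ((w i).eig k) = (p j).eval ((w i).eig k) := by
      intro k
      have h3 : (E * D j j).1.unop ((w i).poly k) = (D i i * E).1.unop ((w i).poly k) := by rw [h1]
      have h4 : (D j j).1.unop (E.1.unop ((w i).poly k))
          = E.1.unop ((D i i).1.unop ((w i).poly k)) := h3
      rw [hp, hp, hc, map_smul, ClassicalWeight.aeval_deltaEnd_poly,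
        ClassicalWeight.aeval_deltaEnd_poly, map_smul, hc, smul_smul, smul_smul] at h4
      have h5 := smul_left_injective ℂ ((w j).isOPS_poly.ne_zero k) h4
      rw [heig]
      rw [heig, mul_comm] at h5
      exact (mul_right_cancel₀ (hc0 k) h5).symm
    -- The eigenvalues are pairwise distinct, hence infinitely many.
    refine eq_of_infinite_eval_eq _ _
      ((Set.infinite_range_of_injective (w i).eig_injective).mono ?_)
    rintro _ ⟨k, rfl⟩
    exact h2 k
  · rintro ⟨p, rfl, hp⟩
    have hunop : ∀ i, (aeval (w i).delta (p i)).1.unop = aeval (w i).deltaEnd (p i) := fun i =>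
      aeval_omega_unop _ _
    constructor
    · rw [mem_algD_diagWeight_iff]
      intro i j
      rcases eq_or_ne i j with rfl | hij
      · rw [Matrix.diagonal_apply_eq, hunop]
        exact (w i).isHom_aeval _
      · rw [Matrix.diagonal_apply_ne _ hij]
        exact ClassicalWeight.isHom_zero _ _
    · intro E hE
      rw [mem_algD_diagWeight_iff] at hE
      ext1 i j
      rw [Matrix.mul_diagonal, Matrix.diagonal_mul]
      refine Omega.ext_unop ?_
      change (aeval (w j).delta (p j)).1.unop * (E i j).1.unop
        = (E i j).1.unop * (aeval (w i).delta (p i)).1.unop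
      rw [hunop, hunop]
      -- A nonzero entry links `w i` to `w j`: then `p i = p j`, and the entry intertwines the two
      -- operators δ.
      by_cases h0 : (E i j).1.unop = 0
      · rw [h0, mul_zero, zero_mul]
      · rw [hp i j ((hE i j).linked (htype i j) h0)]
        exact ((hE i j).comm ((hE i j).eig_eq (htype i j) h0) _).symm

/-- Polynomial evaluation commutes with the algebra maps given by coordinates and by the diagonal
embedding. -/
theorem aeval_diagDelta (q : ℂ[X]) :
    aeval (diagDelta w) q = Matrix.diagonal fun j => aeval (w j).delta q := by
  have h1 : aeval (fun j => (w j).delta) q = fun j => aeval (w j).delta q := by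
    funext j
    exact (aeval_algHom_apply (Pi.evalAlgHom ℂ (fun _ => Omega) j) (fun j => (w j).delta) q).symm
  rw [← h1]
  exact aeval_algHom_apply (Matrix.diagonalAlgHom ℂ) (fun j => (w j).delta) q

theorem centerD_eq_adjoin (j₀ : n) (htype : ∀ i j, (w i).type = (w j).type)
    (hlink : ∀ i j, (w i).Linked (w j)) :
    centerD (diagWeight w) = Algebra.adjoin ℂ {diagDelta w} := by
  ext D
  rw [mem_centerD_diagWeight_iff htype, Algebra.adjoin_singleton_eq_range_aeval, AlgHom.mem_range]
  constructor
  · rintro ⟨p, rfl, hp⟩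
    refine ⟨p j₀, ?_⟩
    rw [aeval_diagDelta]
    congr 1
    funext j
    rw [hp j₀ j (hlink _ _)]
  · rintro ⟨q, rfl⟩
    exact ⟨fun _ => q, aeval_diagDelta q, fun _ _ _ => rfl⟩

end Center

/-! ### Direct sums of blocks -/

theorem directSumWeight_diagWeight {m : ℕ} {k : Fin m → ℕ}
    (w : ∀ i : Fin m, Fin (k i) → ClassicalWeight) :
    directSumWeight (fun i => diagWeight (w i))
      = diagWeight fun x : Σ i, Fin (k i) => w x.1 x.2 := by
  funext x
  exact Matrix.blockDiagonal'_diagonal _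

/-- Both sides consist of the same diagonal operators: no link joins different blocks, so the
constraint on the polynomials splits blockwise. -/
theorem centerD_directSumWeight {m : ℕ} {k : Fin m → ℕ}
    (w : ∀ i : Fin m, Fin (k i) → ClassicalWeight)
    (htype : ∀ i j r l, (w i j).type = (w r l).type)
    (hlink : ∀ i r, i ≠ r → ∀ l j, ¬ (w i l).Linked (w r j)) :
    centerD (directSumWeight fun i => diagWeight (w i))
      = directSumAlg (fun i => centerD (diagWeight (w i))) := by
  ext D
  rw [directSumWeight_diagWeight, mem_centerD_diagWeight_iff fun _ _ => htype _ _ _ _]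
  constructor
  · rintro ⟨p, rfl, hp⟩
    refine ⟨fun i => Matrix.diagonal fun j => aeval (w i j).delta (p ⟨i, j⟩), fun i => ?_,
      (Matrix.blockDiagonal'_diagonal fun i j => aeval (w i j).delta (p ⟨i, j⟩)).symm⟩
    rw [mem_centerD_diagWeight_iff fun _ _ => htype _ _ _ _]
    exact ⟨fun j => p ⟨i, j⟩, rfl, fun j l h => hp ⟨i, j⟩ ⟨i, l⟩ h⟩
  · rintro ⟨M, hM, rfl⟩
    have h1 := fun i => (mem_centerD_diagWeight_iff (w := w i) fun _ _ => htype _ _ _ _).1 (hM i)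
    choose p hMp hp using h1
    refine ⟨fun x => p x.1 x.2, ?_, ?_⟩
    · rw [funext hMp]
      exact Matrix.blockDiagonal'_diagonal _
    · rintro ⟨i, l⟩ ⟨r, j⟩ h
      obtain rfl : i = r := by
        by_contra hne
        exact hlink i r hne l j h
      exact hp i l j h

end MVOP

end

open MVOP in
theorem theorem5p6 (m : ℕ) (k : Fin m → ℕ) (hk : ∀ i, 0 < k i)
    (w : ∀ i : Fin m, Fin (k i) → ClassicalWeight)
    (t : ClassicalType) (htype : ∀ i j, (w i j).type = t)
    (hequiv : ∀ i j l, DarbouxEquiv (w i j) (w i l))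
    (hinequiv : ∀ i r, i ≠ r → ∀ l j, ¬ DarbouxEquiv (w i l) (w r j)) :
    centerD (directSumWeight fun i => diagWeight (w i))
        = directSumAlg (fun i => centerD (diagWeight (w i))) ∧
      directSumAlg (fun i => centerD (diagWeight (w i)))
        = directSumAlg (fun i => Algebra.adjoin ℂ {diagDelta (w i)}) := by
  simp only [ClassicalWeight.darbouxEquiv_iff_linked] at hequiv hinequiv
  refine ⟨centerD_directSumWeight w (fun i j r l => (htype i j).trans (htype r l).symm)
    hinequiv, ?_⟩
  congr 1
  funext i
  exact centerD_eq_adjoin ⟨0, hk i⟩ (fun j l => (htype i j).trans (htype i l).symm) (hequiv i)
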